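/- Let $N\ge 1$ and let $\Omega\subset\mathbb R^N$ be a bounded open set (for instance a bounded domain with Lipschitz boundary). Let $K:\mathbb R^N\setminus\{0\}\to(0,\infty)$ satisfy: $\min\{|x|^2,1\}K(x)\in L^1(\mathbb R^N)$; there are $\alpha>0$ and $s\in(0,1)$ with $N>2s$ such that $K(x)\ge\alpha|x|^{-(N+2s)}$ for all $x\ne0$; and $K(-x)=K(x)$ for all $x\neq 0$. Let $X_K(\Omega)$ be the space of all $u\in L^2(\mathbb R^N)$ with $\int_{\mathbb R^{2N}}(u(x)-u(y))^2K(x-y)\,dx\,dy<\infty$ and $u=0$ a.e. in $\mathbb R^N\setminus\Omega$, with the scalar product $$\langle u,v\rangle=\int_{\mathbb R^{2N}}(u(x)-u(y))(v(x)-v(y))K(x-y)\,dx\,dy$$ and norm $\|u\|=\langle u,u\rangle^{1/2}$. For $\rho\in L^\infty(\Omega)\setminus\{0\}$, a function $u\in X_K(\Omega)\setminus\{0\}$ is an eigenfunction (of $L_Ku=\lambda\rho u$ in $\Omega$, $u=0$ in $\mathbb R^N\setminus\Omega$) if for some $\lambda\in\mathbb R$ $$\langle u,v\rangle=\lambda\int_\Omega\rho\,uv\,dx\quad\text{for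 all }v\in X_K(\Omega),$$ and $\rho$ has the unique continuation property if $|\{x\in\Omega:u(x)=0\}|=0$ for every eigenfunction $u$, whatever $\lambda$. For an integer $j\ge1$ let $\mathcal F_j$ be the family of all $j$-dimensional linear subspaces of $X_K(\Omega)$ and define $$\lambda_j(\rho)^{-1}=\sup_{F\in\mathcal F_j}\ \inf_{u\in F,\ \|u\|=1}\int_\Omega\rho u^2\,dx\quad\text{if }\rho^+\not\equiv0,\qquad \lambda_{-j}(\rho)^{-1}=\inf_{F\in\mathcal F_j}\ \sup_{u\in F,\ \|u\|=1}\int_\Omega\rho u^2\,dx\quad\text{if }\rho^-\not\equiv0.$$ A nonzero integer $k$ is admissible for $\rho$ if either $k>0$ and $\rho^+\not\equiv0$, or $k<0$ and $\rho^-\not\equiv0$. Let $\rho,\tilde\rho\in L^\infty(\Omega)\setminus\{0\}$ satisfy $\rho\le\tilde\rho$ a.e. in $\Omega$ and $\rho\not\equiv\tilde\rho$, and suppose that $\rho$ or $\tilde\rho$ has the unique continuation property. Then $\lambda_k(\rho)>\lambda_k(\tilde\rho)$ for every $k\in\mathbb Z\setminus\{0\}$ that is admissible for both $\rho$ and $\tilde\rho$.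 -/

import Mathlib

open MeasureTheory
open scoped ENNReal

namespace NonlocalEigen

/-- The Euclidean space `ℝ^N`. -/
abbrev E (N : ℕ) : Type := EuclideanSpace ℝ (Fin N)

/-- The hypotheses on the kernel `K : ℝ^N ∖ {0} → (0, ∞)`; the value `K 0` is irrelevant. -/
structure IsKernel {N : ℕ} (K : E N → ℝ) : Prop where
  pos : ∀ x : E N, x ≠ 0 → 0 < K x
  integrable : Integrable (fun x : E N => min (‖x‖ ^ 2) 1 * K x) volume
  lower_bound : ∃ α : ℝ, 0 < α ∧ ∃ s : ℝ, 0 < s ∧ s < 1 ∧ 2 * s < (N : ℝ) ∧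
    ∀ x : E N, x ≠ 0 → α * ‖x‖ ^ (-((N : ℝ) + 2 * s)) ≤ K x
  symm : ∀ x : E N, x ≠ 0 → K (-x) = K x

/-- The scalar product
`⟨u, v⟩ = ∫_{ℝ^{2N}} (u(x) - u(y)) (v(x) - v(y)) K(x - y) dx dy`. -/
noncomputable def form {N : ℕ} (K : E N → ℝ) (u v : Lp ℝ 2 (volume : Measure (E N))) : ℝ :=
  ∫ p : E N × E N, (u p.1 - u p.2) * (v p.1 - v p.2) * K (p.1 - p.2)

/-- The space `X_K(Ω)` of all `u ∈ L²(ℝ^N)` with `[u]_K < ∞` and `u = 0` a.e. outside `Ω`. -/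
def X {N : ℕ} (K : E N → ℝ) (Ω : Set (E N)) : Set (Lp ℝ 2 (volume : Measure (E N))) :=
  {u | Integrable (fun p : E N × E N => (u p.1 - u p.2) ^ 2 * K (p.1 - p.2)) volume ∧
    ∀ᵐ x : E N, x ∉ Ω → u x = 0}

/-- `u ∈ X_K(Ω) ∖ {0}` is an eigenfunction, with eigenvalue `lam`, of `L_K u = lam ρ u` in `Ω`,
`u = 0` outside `Ω`, in the weak sense. -/
def IsEigenfunction {N : ℕ} (K : E N → ℝ) (Ω : Set (E N)) (ρ : Lp ℝ ∞ (volume.restrict Ω))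
    (lam : ℝ) (u : Lp ℝ 2 (volume : Measure (E N))) : Prop :=
  u ∈ X K Ω ∧ u ≠ 0 ∧
    ∀ v ∈ X K Ω, form K u v = lam * ∫ x in Ω, ρ x * (u x * v x)

/-- The unique continuation property of the weight `ρ`. -/
def UCP {N : ℕ} (K : E N → ℝ) (Ω : Set (E N)) (ρ : Lp ℝ ∞ (volume.restrict Ω)) : Prop :=
  ∀ (lam : ℝ) (u : Lp ℝ 2 (volume : Measure (E N))), IsEigenfunction K Ω ρ lam u →
    volume {x ∈ Ω | u x = 0} = 0

/-- The family of all `k`-dimensional linear subspaces of `X_K(Ω)` (used for `k ≥ 1`). -/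
def Subspaces {N : ℕ} (K : E N → ℝ) (Ω : Set (E N)) (k : ℕ) :
    Set (Submodule ℝ (Lp ℝ 2 (volume : Measure (E N)))) :=
  {F | (F : Set (Lp ℝ 2 (volume : Measure (E N)))) ⊆ X K Ω ∧ Module.finrank ℝ F = k}

/-- The unit sphere `{u ∈ F : ‖u‖ = 1}` with respect to the norm of `X_K(Ω)`. -/
def sphere {N : ℕ} (K : E N → ℝ) (F : Submodule ℝ (Lp ℝ 2 (volume : Measure (E N)))) :
    Set (Lp ℝ 2 (volume : Measure (E N))) :=
  {u | u ∈ F ∧ form K u u = 1}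

/-- The variational eigenvalue `λ_k(ρ)`, for `k ≠ 0`: with `j = |k|`,
`λ_j(ρ)⁻¹ = sup_{dim F = j} inf_{u ∈ F, ‖u‖ = 1} ∫_Ω ρ u²` and
`λ_{-j}(ρ)⁻¹ = inf_{dim F = j} sup_{u ∈ F, ‖u‖ = 1} ∫_Ω ρ u²`. -/
noncomputable def eigenvalue {N : ℕ} (K : E N → ℝ) (Ω : Set (E N))
    (ρ : Lp ℝ ∞ (volume.restrict Ω)) (k : ℤ) : ℝ :=
  if 0 < k then
    (⨆ F : Subspaces K Ω k.natAbs, ⨅ u : sphere K F.1, ∫ x in Ω, ρ x * u.1 x ^ 2)⁻¹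
  else
    (⨅ F : Subspaces K Ω k.natAbs, ⨆ u : sphere K F.1, ∫ x in Ω, ρ x * u.1 x ^ 2)⁻¹

/-- The index `k ∈ ℤ ∖ {0}` is admissible for `ρ`: positive indices occur when `ρ⁺ ≢ 0`,
negative ones when `ρ⁻ ≢ 0`. -/
def Admissible {N : ℕ} {Ω : Set (E N)} (ρ : Lp ℝ ∞ (volume.restrict Ω)) (k : ℤ) : Prop :=
  (0 < k ∧ ρ⁺ ≠ 0) ∨ (k < 0 ∧ ρ⁻ ≠ 0)

end NonlocalEigen

/-!
The map `u ↦ (u(x) - u(y)) K(x - y)^{1/2}` identifies `X_K(Ω)` with a Hilbert space inside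
`L²(ℝ^{2N})`. Since `‖x‖ ^ N * K x` blows up at the origin, a function of small energy is close in
`L²` to its mean values over the cells of a fine grid. All but finitely many cells meet `Ω` in at
most half of their volume, and in these the mean value can be absorbed by Cauchy-Schwarz. So
`X_K(Ω)` embeds compactly in `L²`, and `b(u, v) = ∫_Ω ρ u v` is a compact symmetric form on it.

Let `b ≤ b'` be the forms of `ρ ≤ ρ'`. If their `j`-th max-min values were equal to `m`, a dimension
count would give `u ≠ 0` in the span of the first `j` eigenvectors of `b` and orthogonal to the
first `j - 1` eigenvectors of `b'`. Then `m ‖u‖² ≤ b(u, u) ≤ b'(u, u) ≤ m ‖u‖²`, so `u` is an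
eigenvector of both forms; unique continuation makes it nonzero a.e. in `Ω`, whence
`b(u, u) < b'(u, u)`, a contradiction. Negative indices reduce to positive ones by `ρ ↦ -ρ`.
-/

open Filter Topology
open scoped InnerProductSpace

namespace NonlocalEigen

section MinMax

variable {H : Type*} [NormedAddCommGroup H] [InnerProductSpace ℝ H] {b b' : H →L[ℝ] H →L[ℝ] ℝ}

/-- `u` is a weak eigenvector of `b`, with eigenvalue `m`, relative to the scalar product; the
vector `u = 0` is not excluded. -/
def IsFormEigen (b : H →L[ℝ] H →L[ℝ] ℝ) (m : ℝ) (u : H) : Prop :=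
  ∀ v, b u v = m * ⟪u, v⟫_ℝ

theorem exists_norm_eq_one_of_finrank_pos {F : Submodule ℝ H} (hF : 0 < Module.finrank ℝ F) :
    ∃ u ∈ F, ‖u‖ = 1 := by
  have hbot : F ≠ ⊥ := by rintro rfl; simp at hF
  obtain ⟨x, hx, hx0⟩ := F.exists_mem_ne_zero_of_ne_bot hbot
  exact ⟨‖x‖⁻¹ • x, F.smul_mem _ hx, norm_smul_inv_norm hx0⟩

theorem exists_mem_orthogonal_of_finrank_lt (F W : Submodule ℝ H) [FiniteDimensional ℝ W]
    (h : Module.finrank ℝ W < Module.finrank ℝ F) : ∃ u ∈ F, u ∈ Wᗮ ∧ u ≠ 0 := by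
  have : FiniteDimensional ℝ F := Module.finite_of_finrank_pos (by omega)
  let proj : F →ₗ[ℝ] W := (W.orthogonalProjectionOnto : H →ₗ[ℝ] W) ∘ₗ F.subtype
  obtain ⟨x, hx, hx0⟩ :=
    (LinearMap.ker proj).exists_mem_ne_zero_of_ne_bot (LinearMap.ker_ne_bot_of_finrank_lt h)
  exact ⟨x, x.2, Submodule.orthogonalProjectionOnto_eq_zero_iff.1 hx, by simpa using hx0⟩

theorem apply_eq_zero_of_apply_self_eq_zero {B : LinearMap.BilinForm ℝ H}
    (hsymm : ∀ u v, B u v = B v u) {G : Submodule ℝ H} (hnonneg : ∀ v ∈ G, 0 ≤ B v v) {u v : H}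
    (hu : u ∈ G) (huu : B u u = 0) (hv : v ∈ G) : B u v = 0 := by
  have hcs := LinearMap.BilinForm.apply_sq_le_of_symm (B.restrict G)
    (fun x => hnonneg x x.2) ⟨fun x y => hsymm x y⟩ ⟨u, hu⟩ ⟨v, hv⟩
  simpa [huu, sq_nonpos_iff] using hcs

/-! ### Maximizers of the Rayleigh quotient -/

theorem rayleigh_parallelogram (b : H →L[ℝ] H →L[ℝ] ℝ) (M : ℝ) (x y : H) :
    (M * ‖x + y‖ ^ 2 - b (x + y) (x + y)) + (M * ‖x - y‖ ^ 2 - b (x - y) (x - y)) =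
      2 * (M * ‖x‖ ^ 2 - b x x) + 2 * (M * ‖y‖ ^ 2 - b y y) := by
  have h := parallelogram_law_with_norm ℝ x y
  simp only [map_add, map_sub, add_apply, sub_apply]
  linear_combination M * h

theorem form_le_of_norm_eq_one_le {G : Submodule ℝ H} {M : ℝ}
    (hM : ∀ u ∈ G, ‖u‖ = 1 → b u u ≤ M) {v : H} (hv : v ∈ G) : b v v ≤ M * ‖v‖ ^ 2 := by
  rcases eq_or_ne v 0 with rfl | hv0
  · simp
  have hnorm : ‖v‖ ≠ 0 := norm_ne_zero_iff.2 hv0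
  have h := hM _ (G.smul_mem ‖v‖⁻¹ hv) (norm_smul_inv_norm hv0)
  simp only [map_smul, smul_apply, smul_eq_mul] at h
  calc b v v = ‖v‖⁻¹ * (‖v‖⁻¹ * b v v) * ‖v‖ ^ 2 := by field_simp
    _ ≤ M * ‖v‖ ^ 2 := by gcongr

/-- By the parallelogram identity `M ‖x - y‖² ≤ 2 (M - b x x) + 2 (M - b y y) + 2 ‖b x - b y‖` for
unit vectors, so that a maximizing sequence converges as soon as its image under `b` does. -/
theorem cauchySeq_of_tendsto_rayleigh {G : Submodule ℝ H} {M : ℝ} (hM : 0 < M)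
    (hle : ∀ v ∈ G, b v v ≤ M * ‖v‖ ^ 2) {u : ℕ → H} (huG : ∀ n, u n ∈ G) (hu1 : ∀ n, ‖u n‖ = 1)
    (hu : Tendsto (fun n => b (u n) (u n)) atTop (𝓝 M)) (hbu : CauchySeq fun n => b (u n)) :
    CauchySeq u := by
  rw [cauchySeq_iff_tendsto_dist_atTop_0] at hbu ⊢
  have hsq : ∀ p : ℕ × ℕ, dist (u p.1) (u p.2) ^ 2 ≤
      M⁻¹ * (2 * (M - b (u p.1) (u p.1)) + 2 * (M - b (u p.2) (u p.2)) +
        2 * dist (b (u p.1)) (b (u p.2))) := by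
    intro p
    set x := u p.1
    set y := u p.2
    have hpar := rayleigh_parallelogram b M x y
    have hsum := hle _ (G.add_mem (huG p.1) (huG p.2))
    have hdiff : b (x - y) (x - y) ≤ 2 * dist (b x) (b y) := by
      have hxy : ‖x - y‖ ≤ 2 := (norm_sub_le x y).trans (by rw [hu1, hu1]; norm_num)
      rw [dist_eq_norm, ← map_sub, mul_comm]
      exact (le_abs_self _).trans (((b (x - y)).le_opNorm _).trans (by gcongr))
    rw [dist_eq_norm, ← div_eq_inv_mul, le_div_iff₀' hM]
    simp only [hu1, one_pow, mul_one, x, y] at hpar hsum hdiff ⊢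
    linarith
  have hgap : Tendsto (fun n => M - b (u n) (u n)) atTop (𝓝 0) := by
    simpa using hu.const_sub M
  have hlim : Tendsto (fun p : ℕ × ℕ => dist (u p.1) (u p.2) ^ 2) atTop (𝓝 0) := by
    refine squeeze_zero (fun _ => sq_nonneg _) hsq ?_
    rw [← prod_atTop_atTop_eq] at hbu ⊢
    simpa using ((((hgap.comp tendsto_fst).const_mul 2).add
      ((hgap.comp tendsto_snd).const_mul 2)).add (hbu.const_mul 2)).const_mul M⁻¹
  simpa using hlim.sqrt

theorem exists_rayleigh_max [CompleteSpace H] (hb : IsCompactOperator b) {G : Submodule ℝ H}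
    (hG : IsClosed (G : Set H)) (hpos : ∃ u ∈ G, 0 < b u u) :
    ∃ u ∈ G, ‖u‖ = 1 ∧ 0 < b u u ∧ ∀ v ∈ G, b v v ≤ b u u * ‖v‖ ^ 2 := by
  set values : Set ℝ := (fun u => b u u) '' {u | u ∈ G ∧ ‖u‖ = 1}
  have hbdd : BddAbove values := by
    refine ⟨‖b‖, ?_⟩
    rintro _ ⟨u, ⟨-, hu1⟩, rfl⟩
    simpa [hu1] using (le_abs_self _).trans (b.le_opNorm₂ u u)
  have hle : ∀ v ∈ G, b v v ≤ sSup values * ‖v‖ ^ 2 := fun v hv =>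
    form_le_of_norm_eq_one_le (fun u hu hu1 => le_csSup hbdd ⟨u, ⟨hu, hu1⟩, rfl⟩) hv
  obtain ⟨v, hvG, hv⟩ := hpos
  have hM : 0 < sSup values := pos_of_mul_pos_left (hv.trans_le (hle v hvG)) (sq_nonneg _)
  have hne : values.Nonempty := by
    by_contra h
    simp [Set.not_nonempty_iff_eq_empty.1 h] at hM
  obtain ⟨t, -, ht, htv⟩ := exists_seq_tendsto_sSup hne hbdd
  choose u hu hut using htv
  obtain ⟨S, hS, hSb⟩ := IsCompactOperator.image_closedBall_subset_compact hb 1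
  obtain ⟨y, -, φ, hφ, hy⟩ := hS.tendsto_subseq (x := fun n => b (u n))
    fun n => hSb ⟨u n, by simp [(hu n).2], rfl⟩
  have hlim : Tendsto (fun n => b (u (φ n)) (u (φ n))) atTop (𝓝 (sSup values)) := by
    simpa only [hut, Function.comp_def] using ht.comp hφ.tendsto_atTop
  obtain ⟨x, hx⟩ := cauchySeq_tendsto_of_complete <| cauchySeq_of_tendsto_rayleigh hM hle
    (fun n => (hu (φ n)).1) (fun n => (hu (φ n)).2) hlim hy.cauchySeq
  have hx1 : ‖x‖ = 1 := tendsto_nhds_unique hx.norm (by simp [fun n => (hu n).2])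
  have hxM : b x x = sSup values :=
    tendsto_nhds_unique (((show Continuous fun z => b z z by fun_prop).tendsto x).comp hx) hlim
  exact ⟨x, hG.mem_of_tendsto hx (.of_forall fun n => (hu (φ n)).1), hx1, hxM ▸ hM, hxM ▸ hle⟩

/-! ### Top subspaces and minimax values -/

/-- `W` is invariant under `b` and carries the part of its spectrum above `m`: `b ≥ m ‖·‖²` on `W`
and `b ≤ m ‖·‖²` on the orthogonal complement. -/
structure IsTopSubspace (b : H →L[ℝ] H →L[ℝ] ℝ) (W : Submodule ℝ H) (m : ℝ) : Prop where
  invariant : ∀ w ∈ W, ∀ v ∈ Wᗮ, b w v = 0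
  le_form : ∀ w ∈ W, m * ‖w‖ ^ 2 ≤ b w w
  form_le : ∀ v ∈ Wᗮ, b v v ≤ m * ‖v‖ ^ 2

theorem isTopSubspace_bot (b : H →L[ℝ] H →L[ℝ] ℝ) : IsTopSubspace b ⊥ ‖b‖ where
  invariant w hw v _ := by simp [(Submodule.mem_bot ℝ).1 hw]
  le_form w hw := by simp [(Submodule.mem_bot ℝ).1 hw]
  form_le v _ := by
    simpa [pow_two, mul_assoc] using (le_abs_self _).trans (b.le_opNorm₂ v v)

namespace IsTopSubspace

variable {W : Submodule ℝ H} {m : ℝ} {u : H}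

theorem isFormEigen_of_mem [FiniteDimensional ℝ W] (hW : IsTopSubspace b W m)
    (hsymm : ∀ u v, b u v = b v u) (hu : u ∈ W) (hum : b u u = m * ‖u‖ ^ 2) :
    IsFormEigen b m u := by
  intro z
  obtain ⟨w, hw, v, hv, rfl⟩ := W.exists_add_mem_mem_orthogonal z
  have hzero := apply_eq_zero_of_apply_self_eq_zero (B := b.toBilinForm - m • innerₗ H)
    (fun x y => by simp [hsymm x y, real_inner_comm x y])
    (fun w hw => by simpa using hW.le_form w hw) hu (by simp [hum]) hw
  rw [map_add, inner_add_right, hW.invariant u hu v hv, hv u hu]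
  simpa [sub_eq_zero] using hzero

theorem isFormEigen_of_mem_orthogonal [FiniteDimensional ℝ W] (hW : IsTopSubspace b W m)
    (hsymm : ∀ u v, b u v = b v u) (hu : u ∈ Wᗮ) (hum : b u u = m * ‖u‖ ^ 2) :
    IsFormEigen b m u := by
  intro z
  obtain ⟨w, hw, v, hv, rfl⟩ := W.exists_add_mem_mem_orthogonal z
  have hzero := apply_eq_zero_of_apply_self_eq_zero (B := m • innerₗ H - b.toBilinForm)
    (fun x y => by simp [hsymm x y, real_inner_comm x y])
    (fun v hv => by simpa using hW.form_le v hv) hu (by simp [hum]) hv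
  rw [map_add, inner_add_right, hsymm u w, hW.invariant w hw u hu,
    Submodule.inner_left_of_mem_orthogonal hw hu]
  exact (sub_eq_zero.1 (by simpa using hzero)).symm

theorem of_rayleigh_max (hW : IsTopSubspace b W m) (hu : u ∈ Wᗮ) (hu1 : ‖u‖ = 1)
    (hmax : ∀ v ∈ Wᗮ, b v v ≤ b u u * ‖v‖ ^ 2) : IsTopSubspace b W (b u u) where
  invariant := hW.invariant
  le_form w hw :=
    (mul_le_mul_of_nonneg_right (by simpa [hu1] using hW.form_le u hu) (sq_nonneg _)).trans
      (hW.le_form w hw)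
  form_le := hmax

theorem apply_add_self (hW : IsTopSubspace b W m) (hsymm : ∀ u v, b u v = b v u) {w v : H}
    (hw : w ∈ W) (hv : v ∈ Wᗮ) : b (w + v) (w + v) = b w w + b v v := by
  simp only [map_add, add_apply, hsymm v w, hW.invariant w hw v hv, add_zero, zero_add]

theorem sup_span_singleton [FiniteDimensional ℝ W] (hW : IsTopSubspace b W (b u u))
    (hsymm : ∀ u v, b u v = b v u) (hu : u ∈ Wᗮ) (hu1 : ‖u‖ = 1) :
    IsTopSubspace b (W ⊔ ℝ ∙ u) (b u u) where
  invariant z hz v hv := by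
    obtain ⟨w, hw, y, hy, rfl⟩ := Submodule.mem_sup.1 hz
    obtain ⟨t, rfl⟩ := Submodule.mem_span_singleton.1 hy
    have hvW : v ∈ Wᗮ := Submodule.orthogonal_le le_sup_left hv
    have huv : ⟪u, v⟫_ℝ = 0 :=
      hv u (Submodule.mem_sup_right (Submodule.mem_span_singleton_self u))
    have hbuv : b u v = 0 := by
      rw [hW.isFormEigen_of_mem_orthogonal hsymm hu (by simp [hu1]) v, huv, mul_zero]
    simp [hW.invariant w hw v hvW, hbuv]
  le_form z hz := by
    obtain ⟨w, hw, y, hy, rfl⟩ := Submodule.mem_sup.1 hz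
    obtain ⟨t, rfl⟩ := Submodule.mem_span_singleton.1 hy
    have htu : t • u ∈ Wᗮ := Wᗮ.smul_mem t hu
    have hnorm : ‖w + t • u‖ ^ 2 = ‖w‖ ^ 2 + t ^ 2 := by
      rw [norm_add_sq_real, htu w hw, norm_smul, hu1]
      simp
    rw [hW.apply_add_self hsymm hw htu, hnorm, mul_add]
    refine add_le_add (hW.le_form w hw) (le_of_eq ?_)
    simp only [map_smul, smul_apply, smul_eq_mul]
    ring
  form_le v hv := hW.form_le v (Submodule.orthogonal_le le_sup_left hv)

theorem exists_extension [CompleteSpace H] (hb : IsCompactOperator b)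
    (hsymm : ∀ u v, b u v = b v u) [FiniteDimensional ℝ W] (hW : IsTopSubspace b W m)
    (hpos : ∃ v ∈ Wᗮ, 0 < b v v) :
    ∃ (W' : Submodule ℝ H) (m' : ℝ), Module.finrank ℝ W' = Module.finrank ℝ W + 1 ∧ 0 < m' ∧
      IsTopSubspace b W m' ∧ IsTopSubspace b W' m' := by
  obtain ⟨u, hu, hu1, hupos, hmax⟩ := exists_rayleigh_max hb W.isClosed_orthogonal hpos
  have hu0 : u ≠ 0 := norm_ne_zero_iff.1 (hu1 ▸ one_ne_zero)
  have hdisj : Disjoint W (ℝ ∙ u) := W.orthogonal_disjoint.mono_right (by simpa using hu)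
  have hrank := Submodule.finrank_sup_add_finrank_inf_eq W (ℝ ∙ u)
  rw [hdisj.eq_bot, finrank_bot, add_zero, finrank_span_singleton hu0] at hrank
  exact ⟨W ⊔ ℝ ∙ u, b u u, hrank, hupos, hW.of_rayleigh_max hu hu1 hmax,
    (hW.of_rayleigh_max hu hu1 hmax).sup_span_singleton hsymm hu hu1⟩

end IsTopSubspace

/-- `b` is positive definite on some `j`-dimensional subspace, that is, its positive index is at
least `j`. -/
def HasPositiveSubspace (b : H →L[ℝ] H →L[ℝ] ℝ) (j : ℕ) : Prop :=
  ∃ F : Submodule ℝ H, Module.finrank ℝ F = j ∧ ∀ u ∈ F, u ≠ 0 → 0 < b u u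

theorem HasPositiveSubspace.mono {j : ℕ} (hj : HasPositiveSubspace b j)
    (hle : ∀ u, b u u ≤ b' u u) : HasPositiveSubspace b' j := by
  obtain ⟨F, hF, hpos⟩ := hj
  exact ⟨F, hF, fun u hu hu0 => (hpos u hu hu0).trans_le (hle u)⟩

theorem exists_isTopSubspace_pair [CompleteSpace H] (hb : IsCompactOperator b)
    (hsymm : ∀ u v, b u v = b v u) {j n : ℕ} (hn : HasPositiveSubspace b n) (hj : j < n) :
    ∃ (V W : Submodule ℝ H) (m : ℝ), Module.Finite ℝ V ∧ Module.finrank ℝ V = j ∧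
      Module.finrank ℝ W = j + 1 ∧ 0 < m ∧ IsTopSubspace b V m ∧ IsTopSubspace b W m := by
  obtain ⟨F, rfl, hpos⟩ := hn
  have extend : ∀ (V : Submodule ℝ H) (m : ℝ) [Module.Finite ℝ V],
      Module.finrank ℝ V < Module.finrank ℝ F → IsTopSubspace b V m →
      ∃ (W : Submodule ℝ H) (m' : ℝ), Module.finrank ℝ W = Module.finrank ℝ V + 1 ∧ 0 < m' ∧
        IsTopSubspace b V m' ∧ IsTopSubspace b W m' := by
    intro V m _ hV hVm
    obtain ⟨v, hvF, hvV, hv0⟩ := exists_mem_orthogonal_of_finrank_lt F V hV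
    exact hVm.exists_extension hb hsymm ⟨v, hvV, hpos v hvF hv0⟩
  induction j with
  | zero =>
    obtain ⟨W, m, hW, hm, hbot, hWm⟩ := extend ⊥ ‖b‖ (by simpa using hj) (isTopSubspace_bot b)
    exact ⟨⊥, W, m, inferInstance, finrank_bot ℝ H, by simpa using hW, hm, hbot, hWm⟩
  | succ j ih =>
    obtain ⟨-, V, m, -, -, hV, -, -, hVm⟩ := ih (by omega)
    have : Module.Finite ℝ V := Module.finite_of_finrank_pos (by omega)
    obtain ⟨W, m', hW, hm', hVm', hWm'⟩ := extend V m (by omega) hVm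
    exact ⟨V, W, m', this, hV, by omega, hm', hVm', hWm'⟩

/-- The minimax value `sup_{dim F = j} inf_{u ∈ F, ‖u‖ = 1} b(u, u)`; for `j = 0` the infimum is
over the empty set and hence `0`. -/
noncomputable def minimaxValue (b : H →L[ℝ] H →L[ℝ] ℝ) (j : ℕ) : ℝ :=
  ⨆ F : {F : Submodule ℝ H // Module.finrank ℝ F = j}, ⨅ u : {u : H // u ∈ F.1 ∧ ‖u‖ = 1}, b u.1 u.1

theorem abs_apply_self_le_of_norm_eq_one (b : H →L[ℝ] H →L[ℝ] ℝ) {u : H} (hu : ‖u‖ = 1) :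
    |b u u| ≤ ‖b‖ := by
  simpa [hu] using b.le_opNorm₂ u u

theorem iInf_sphere_le (b : H →L[ℝ] H →L[ℝ] ℝ) {F : Submodule ℝ H} {v : H} (hv : v ∈ F)
    (hv1 : ‖v‖ = 1) : ⨅ u : {u : H // u ∈ F ∧ ‖u‖ = 1}, b u.1 u.1 ≤ b v v := by
  refine ciInf_le ⟨-‖b‖, ?_⟩ (⟨v, hv, hv1⟩ : {u : H // u ∈ F ∧ ‖u‖ = 1})
  rintro _ ⟨u, rfl⟩
  exact neg_le_of_abs_le (abs_apply_self_le_of_norm_eq_one b u.2.2)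

theorem minimaxValue_le {V : Submodule ℝ H} [FiniteDimensional ℝ V] {m : ℝ} (hm : 0 ≤ m)
    {j : ℕ} (hV : Module.finrank ℝ V < j) (hle : ∀ v ∈ Vᗮ, b v v ≤ m * ‖v‖ ^ 2) :
    minimaxValue b j ≤ m := by
  refine Real.iSup_le (fun F => ?_) hm
  obtain ⟨u, huF, huV, hu0⟩ := exists_mem_orthogonal_of_finrank_lt F.1 V (by rwa [F.2])
  have hu1 : ‖‖u‖⁻¹ • u‖ = 1 := norm_smul_inv_norm hu0
  refine (iInf_sphere_le b (F.1.smul_mem _ huF) hu1).trans ?_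
  simpa only [hu1, one_pow, mul_one] using hle _ (Vᗮ.smul_mem ‖u‖⁻¹ huV)

theorem le_minimaxValue {W : Submodule ℝ H} {m : ℝ} {j : ℕ} (hj : 0 < j)
    (hW : Module.finrank ℝ W = j) (hle : ∀ w ∈ W, m * ‖w‖ ^ 2 ≤ b w w) :
    m ≤ minimaxValue b j := by
  subst hW
  obtain ⟨w, hw, hw1⟩ := exists_norm_eq_one_of_finrank_pos hj
  have : Nonempty {u : H // u ∈ W ∧ ‖u‖ = 1} := ⟨⟨w, hw, hw1⟩⟩
  have hinf : m ≤ ⨅ u : {u : H // u ∈ W ∧ ‖u‖ = 1}, b u.1 u.1 :=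
    le_ciInf fun v => by simpa [v.2.2] using hle v.1 v.2.1
  refine le_ciSup_of_le ⟨‖b‖, ?_⟩ ⟨W, rfl⟩ hinf
  rintro _ ⟨⟨F, hF⟩, rfl⟩
  obtain ⟨u, hu, hu1⟩ := exists_norm_eq_one_of_finrank_pos (hF ▸ hj)
  exact (iInf_sphere_le b hu hu1).trans (le_of_abs_le (abs_apply_self_le_of_norm_eq_one b hu1))

theorem exists_isTopSubspace_minimaxValue [CompleteSpace H] (hb : IsCompactOperator b)
    (hsymm : ∀ u v, b u v = b v u) {j : ℕ} (hj : 0 < j) (hpos : HasPositiveSubspace b j) :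
    ∃ V W : Submodule ℝ H, Module.Finite ℝ V ∧ Module.finrank ℝ V < j ∧ Module.finrank ℝ W = j ∧
      0 < minimaxValue b j ∧ IsTopSubspace b V (minimaxValue b j) ∧
      IsTopSubspace b W (minimaxValue b j) := by
  obtain ⟨V, W, m, hVfin, hV, hW, hm, hVm, hWm⟩ :=
    exists_isTopSubspace_pair hb hsymm hpos (Nat.sub_one_lt_of_lt hj)
  have hVj : Module.finrank ℝ V < j := by omega
  have hWj : Module.finrank ℝ W = j := by omega
  obtain rfl : minimaxValue b j = m :=
    (minimaxValue_le hm.le hVj hVm.form_le).antisymm (le_minimaxValue hj hWj hWm.le_form)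
  exact ⟨V, W, hVfin, hVj, hWj, hm, hVm, hWm⟩

theorem minimaxValue_pos [CompleteSpace H] (hb : IsCompactOperator b)
    (hsymm : ∀ u v, b u v = b v u) {j : ℕ} (hj : 0 < j) (hpos : HasPositiveSubspace b j) :
    0 < minimaxValue b j := by
  obtain ⟨-, -, -, -, -, h, -, -⟩ := exists_isTopSubspace_minimaxValue hb hsymm hj hpos
  exact h

/-- A vector `u ≠ 0` lying both in the top subspace of `b` and in the complement of that of `b'`
satisfies `μ ‖u‖² ≤ b u u ≤ b' u u ≤ μ' ‖u‖²`, and is an eigenvector of both forms if `μ' ≤ μ`. -/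
theorem minimaxValue_lt [CompleteSpace H] (hb : IsCompactOperator b)
    (hb' : IsCompactOperator b') (hsymm : ∀ u v, b u v = b v u) (hsymm' : ∀ u v, b' u v = b' v u)
    {j : ℕ} (hj : 0 < j) (hpos : HasPositiveSubspace b j) (hle : ∀ u, b u u ≤ b' u u)
    (hlt : ∀ m u, 0 < m → u ≠ 0 → IsFormEigen b m u → IsFormEigen b' m u → b u u < b' u u) :
    minimaxValue b j < minimaxValue b' j := by
  obtain ⟨-, W, -, -, hWj, hμ, -, hW⟩ := exists_isTopSubspace_minimaxValue hb hsymm hj hpos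
  obtain ⟨V, -, _, hVj, -, -, hV, -⟩ :=
    exists_isTopSubspace_minimaxValue hb' hsymm' hj (hpos.mono hle)
  have : Module.Finite ℝ W := Module.finite_of_finrank_pos (by omega)
  obtain ⟨u, huW, huV, hu0⟩ := exists_mem_orthogonal_of_finrank_lt W V (by omega)
  have hbu := hW.le_form u huW
  have hbu' := hV.form_le u huV
  by_contra! hμ'
  have hmul := mul_le_mul_of_nonneg_right hμ' (sq_nonneg ‖u‖)
  have hμeq : minimaxValue b' j = minimaxValue b j := by
    refine hμ'.antisymm (le_of_mul_le_mul_right ?_ (pow_pos (norm_pos_iff.2 hu0) 2))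
    exact hbu.trans ((hle u).trans hbu')
  rw [hμeq] at hbu' hV
  have heig := hW.isFormEigen_of_mem hsymm huW (le_antisymm ((hle u).trans hbu') hbu)
  have heig' := hV.isFormEigen_of_mem_orthogonal hsymm' huV
    (le_antisymm hbu' (hbu.trans (hle u)))
  exact (hlt _ u hμ hu0 heig heig').not_ge (hbu'.trans hbu)

end MinMax

variable {N : ℕ} {K : E N → ℝ} {Ω : Set (E N)}

/-! ### Kernels and their energy space -/

section Kernel

/-- The properties of a kernel on which the theory rests; symmetry is not among them. The blow-up
of `‖x‖ ^ N * K x` at the origin makes the embedding of `X_K(Ω)` into `L²` compact. -/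
structure IsCoerciveKernel (K : E N → ℝ) : Prop where
  dim_pos : 0 < N
  integrable : Integrable (fun x : E N => min (‖x‖ ^ 2) 1 * K x) volume
  lower_bound : ∀ R : ℝ, ∃ c : ℝ, 0 < c ∧ ∀ x : E N, x ≠ 0 → ‖x‖ ≤ R → c ≤ K x
  tendsto_atTop : Tendsto (fun x : E N => ‖x‖ ^ N * K x) (𝓝[≠] 0) atTop

theorem norm_pow_mul_rpow_neg_add {x : E N} (hx : x ≠ 0) (t : ℝ) :
    ‖x‖ ^ N * ‖x‖ ^ (-((N : ℝ) + t)) = ‖x‖ ^ (-t) := by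
  rw [← Real.rpow_natCast, ← Real.rpow_add (norm_pos_iff.2 hx)]
  congr 1
  ring

theorem IsKernel.isCoerciveKernel (hK : IsKernel K) : IsCoerciveKernel K := by
  obtain ⟨α, hα, s, hs, -, hsN, hle⟩ := hK.lower_bound
  refine ⟨?_, hK.integrable, fun R => ?_, ?_⟩
  · exact_mod_cast (mul_pos two_pos hs).trans hsN
  · refine ⟨α * max R 1 ^ (-((N : ℝ) + 2 * s)), by positivity, fun x hx hxR => ?_⟩
    refine le_trans ?_ (hle x hx)
    exact mul_le_mul_of_nonneg_left (Real.rpow_le_rpow_of_nonpos (norm_pos_iff.2 hx)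
      (hxR.trans (le_max_left R 1)) (by linarith)) hα.le
  · have hpow : Tendsto (fun x : E N => α * ‖x‖ ^ (-(2 * s))) (𝓝[≠] 0) atTop :=
      ((tendsto_rpow_neg_nhdsGT_zero (by linarith)).comp
        tendsto_norm_nhdsNE_zero).const_mul_atTop hα
    refine tendsto_atTop_mono' _ ?_ hpow
    filter_upwards [self_mem_nhdsWithin] with x hx
    rw [← norm_pow_mul_rpow_neg_add hx, mul_left_comm]
    exact mul_le_mul_of_nonneg_left (hle x hx) (by positivity)

namespace IsCoerciveKernel

theorem pos (hK : IsCoerciveKernel K) {x : E N} (hx : x ≠ 0) : 0 < K x := by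
  obtain ⟨c, hc, hcK⟩ := hK.lower_bound ‖x‖
  exact hc.trans_le (hcK x hx le_rfl)

theorem nontrivial (hK : IsCoerciveKernel K) : Nontrivial (E N) :=
  Module.nontrivial_of_finrank_pos (R := ℝ) (by simpa using hK.dim_pos)

theorem ae_ne_zero (hK : IsCoerciveKernel K) : ∀ᵐ x : E N, x ≠ 0 :=
  have := hK.nontrivial
  Measure.ae_ne volume 0

theorem aestronglyMeasurable (hK : IsCoerciveKernel K) :
    AEStronglyMeasurable K (volume : Measure (E N)) := by
  have hmin : Measurable fun x : E N => (min (‖x‖ ^ 2) 1)⁻¹ := by fun_prop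
  refine (hmin.aestronglyMeasurable.mul hK.integrable.aestronglyMeasurable).congr ?_
  filter_upwards [hK.ae_ne_zero] with x hx
  have hx0 : min (‖x‖ ^ 2) 1 ≠ 0 := (lt_min (pow_pos (norm_pos_iff.2 hx) 2) one_pos).ne'
  simp [hx0]

theorem ae_ne_fst_snd (hK : IsCoerciveKernel K) : ∀ᵐ p : E N × E N, p.1 ≠ p.2 := by
  filter_upwards [(quasiMeasurePreserving_sub volume volume).ae hK.ae_ne_zero] with p hp
    using sub_ne_zero.1 hp

theorem exists_forall_le_pow_mul (hK : IsCoerciveKernel K) (M : ℝ) :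
    ∃ h : ℝ, 0 < h ∧ ∀ x : E N, x ≠ 0 → ‖x‖ ≤ √N * h → M ≤ h ^ N * K x := by
  have hN : 0 < √N := Real.sqrt_pos.2 (by exact_mod_cast hK.dim_pos)
  have hev : ∀ᶠ x : E N in 𝓝[≠] 0, √N ^ N * M ≤ ‖x‖ ^ N * K x :=
    hK.tendsto_atTop.eventually_ge_atTop _
  obtain ⟨r, hr, hball⟩ := Metric.eventually_nhds_iff.1 (eventually_nhdsWithin_iff.1 hev)
  refine ⟨r / (2 * √N), by positivity, fun x hx hxr => ?_⟩
  have hxr' : ‖x‖ < r := hxr.trans_lt <| by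
    rw [mul_div_assoc', mul_comm, mul_div_mul_right _ _ hN.ne']
    exact half_lt_self hr
  refine le_of_mul_le_mul_left ?_ (pow_pos hN N)
  calc √N ^ N * M ≤ ‖x‖ ^ N * K x := hball (by rwa [dist_zero_right]) hx
    _ ≤ (√N * (r / (2 * √N))) ^ N * K x := by
      have := (hK.pos hx).le
      gcongr
    _ = √N ^ N * ((r / (2 * √N)) ^ N * K x) := by rw [mul_pow, mul_assoc]

end IsCoerciveKernel

end Kernel

section WeightedDifference

/-- The weighted difference `(u(x) - u(y)) K(x - y)^{1/2}`, whose square is the energy density. -/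
noncomputable def wdiff (K : E N → ℝ) : (E N → ℝ) →ₗ[ℝ] (E N × E N → ℝ) where
  toFun u p := (u p.1 - u p.2) * √(K (p.1 - p.2))
  map_add' u v := by
    ext p
    simp only [Pi.add_apply]
    ring
  map_smul' c u := by
    ext p
    simp only [Pi.smul_apply, smul_eq_mul, RingHom.id_apply]
    ring

theorem wdiff_apply (K : E N → ℝ) (u : E N → ℝ) (p : E N × E N) :
    wdiff K u p = (u p.1 - u p.2) * √(K (p.1 - p.2)) := rfl

theorem wdiff_ae_congr {u v : E N → ℝ} (huv : u =ᵐ[volume] v) :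
    wdiff K u =ᵐ[volume] wdiff K v := by
  filter_upwards [Measure.quasiMeasurePreserving_fst.ae huv,
    Measure.quasiMeasurePreserving_snd.ae huv] with p hfst hsnd
  rw [wdiff_apply, wdiff_apply, hfst, hsnd]

namespace IsCoerciveKernel

theorem wdiff_mul_wdiff (hK : IsCoerciveKernel K) (u v : E N → ℝ) :
    wdiff K u * wdiff K v =ᵐ[volume]
      fun p => (u p.1 - u p.2) * (v p.1 - v p.2) * K (p.1 - p.2) := by
  filter_upwards [hK.ae_ne_fst_snd] with p hp
  rw [Pi.mul_apply, wdiff_apply, wdiff_apply, mul_mul_mul_comm,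
    Real.mul_self_sqrt (hK.pos (sub_ne_zero.2 hp)).le]

theorem aestronglyMeasurable_wdiff (hK : IsCoerciveKernel K) {u : E N → ℝ}
    (hu : AEStronglyMeasurable u volume) : AEStronglyMeasurable (wdiff K u) volume :=
  (hu.comp_fst.sub hu.comp_snd).mul <| Real.continuous_sqrt.comp_aestronglyMeasurable <|
    hK.aestronglyMeasurable.comp_quasiMeasurePreserving (quasiMeasurePreserving_sub volume volume)

theorem memLp_wdiff_iff (hK : IsCoerciveKernel K) {u : E N → ℝ}
    (hu : AEStronglyMeasurable u volume) : MemLp (wdiff K u) 2 volume ↔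
      Integrable (fun p : E N × E N => (u p.1 - u p.2) ^ 2 * K (p.1 - p.2)) volume := by
  rw [memLp_two_iff_integrable_sq (hK.aestronglyMeasurable_wdiff hu)]
  refine integrable_congr ?_
  filter_upwards [hK.wdiff_mul_wdiff u u] with p hp
  simpa only [sq, Pi.mul_apply] using hp

theorem mem_X_iff (hK : IsCoerciveKernel K) {u : Lp ℝ 2 (volume : Measure (E N))} :
    u ∈ X K Ω ↔ MemLp (wdiff K u) 2 volume ∧ ∀ᵐ x : E N, x ∉ Ω → u x = 0 :=
  and_congr_left fun _ => (hK.memLp_wdiff_iff (Lp.aestronglyMeasurable u)).symm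

end IsCoerciveKernel

/-- The set `X_K(Ω)` as a linear subspace of `L²(ℝ^N)`. -/
def XSubmodule (hK : IsCoerciveKernel K) (Ω : Set (E N)) :
    Submodule ℝ (Lp ℝ 2 (volume : Measure (E N))) where
  carrier := X K Ω
  zero_mem' := by
    have hzero := Lp.coeFn_zero ℝ 2 (volume : Measure (E N))
    refine hK.mem_X_iff.2 ⟨(memLp_congr_ae (wdiff_ae_congr hzero)).2 (by simp), ?_⟩
    filter_upwards [hzero] with x hx _ using hx
  add_mem' {u v} hu hv := by
    have hadd := Lp.coeFn_add u v
    obtain ⟨huE, hu⟩ := hK.mem_X_iff.1 hu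
    obtain ⟨hvE, hv⟩ := hK.mem_X_iff.1 hv
    refine hK.mem_X_iff.2 ⟨(memLp_congr_ae (wdiff_ae_congr hadd)).2 ?_, ?_⟩
    · rw [map_add]
      exact huE.add hvE
    · filter_upwards [hadd, hu, hv] with x hx hux hvx hxΩ
      rw [hx, Pi.add_apply, hux hxΩ, hvx hxΩ, add_zero]
  smul_mem' c u hu := by
    have hsmul := Lp.coeFn_smul c u
    obtain ⟨huE, hu⟩ := hK.mem_X_iff.1 hu
    refine hK.mem_X_iff.2 ⟨(memLp_congr_ae (wdiff_ae_congr hsmul)).2 ?_, ?_⟩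
    · rw [map_smul]
      exact huE.const_smul c
    · filter_upwards [hsmul, hu] with x hx hux hxΩ
      rw [hx, Pi.smul_apply, hux hxΩ, smul_zero]

/-- The weighted difference as a map from `X_K(Ω)` to `L²(ℝ^{2N})`; it carries the scalar product
of `X_K(Ω)` to that of `L²`. -/
noncomputable def wdiffLp (hK : IsCoerciveKernel K) (Ω : Set (E N)) :
    XSubmodule hK Ω →ₗ[ℝ] Lp ℝ 2 (volume : Measure (E N × E N)) where
  toFun u := (hK.mem_X_iff.1 u.2).1.toLp _
  map_add' u v := by
    rw [← MemLp.toLp_add]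
    exact MemLp.toLp_congr _ _ ((wdiff_ae_congr (Lp.coeFn_add u.1 v.1)).trans (by rw [map_add]))
  map_smul' c u := by
    rw [RingHom.id_apply, ← MemLp.toLp_const_smul]
    exact MemLp.toLp_congr _ _ ((wdiff_ae_congr (Lp.coeFn_smul c u.1)).trans (by rw [map_smul]))

theorem coeFn_wdiffLp (hK : IsCoerciveKernel K) (u : XSubmodule hK Ω) :
    wdiffLp hK Ω u =ᵐ[volume] wdiff K u.1 :=
  MemLp.coeFn_toLp (hK.mem_X_iff.1 u.2).1

theorem inner_wdiffLp (hK : IsCoerciveKernel K) (u v : XSubmodule hK Ω) :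
    ⟪wdiffLp hK Ω u, wdiffLp hK Ω v⟫_ℝ = form K u v := by
  rw [L2.inner_def, form]
  refine integral_congr_ae ?_
  filter_upwards [coeFn_wdiffLp hK u, coeFn_wdiffLp hK v, hK.wdiff_mul_wdiff u v] with p hu hv huv
  rw [hu, hv, ← huv]
  simp [mul_comm]

end WeightedDifference

/-! ### Energy estimates on grid cells -/

section Variance

variable {α : Type*} [MeasurableSpace α] {μ : Measure α}

theorem norm_sq_eq_integral (u : Lp ℝ 2 μ) : ‖u‖ ^ 2 = ∫ x, u x ^ 2 ∂μ := by
  rw [← real_inner_self_eq_norm_sq, L2.inner_def]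
  simp only [RCLike.inner_apply, conj_trivial, sq]

theorem integrable_sq_sub_prod [IsFiniteMeasure μ] {w : α → ℝ} (hw : MemLp w 2 μ) :
    Integrable (fun p : α × α => (w p.1 - w p.2) ^ 2) (μ.prod μ) :=
  ((hw.comp_fst μ).sub (hw.comp_snd μ)).integrable_sq

theorem integral_sq_sub_prod [IsFiniteMeasure μ] {w : α → ℝ} (hw : MemLp w 2 μ) :
    ∫ p : α × α, (w p.1 - w p.2) ^ 2 ∂μ.prod μ =
      2 * (μ.real Set.univ * ∫ x, w x ^ 2 ∂μ - (∫ x, w x ∂μ) ^ 2) := by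
  have hint : Integrable w μ := hw.integrable one_le_two
  have hfst : Integrable (fun p : α × α => w p.1 ^ 2) (μ.prod μ) := hw.integrable_sq.comp_fst μ
  have hsnd : Integrable (fun p : α × α => w p.2 ^ 2) (μ.prod μ) := hw.integrable_sq.comp_snd μ
  have hmul : Integrable (fun p : α × α => 2 * (w p.1 * w p.2)) (μ.prod μ) :=
    (hint.mul_prod hint).const_mul 2
  have hexpand : ∀ p : α × α,
      (w p.1 - w p.2) ^ 2 = w p.1 ^ 2 + w p.2 ^ 2 - 2 * (w p.1 * w p.2) := fun p => by ring
  simp_rw [hexpand]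
  rw [integral_sub (f := fun p => w p.1 ^ 2 + w p.2 ^ 2) (hfst.add hsnd) hmul,
    integral_add hfst hsnd, integral_const_mul, integral_prod_mul,
    integral_fun_fst (fun x => w x ^ 2), integral_fun_snd (fun x => w x ^ 2)]
  simp only [smul_eq_mul]
  ring

theorem sq_integral_le [IsFiniteMeasure μ] {w : α → ℝ} (hw : MemLp w 2 μ) :
    (∫ x, w x ∂μ) ^ 2 ≤ μ.real Set.univ * ∫ x, w x ^ 2 ∂μ := by
  have hnonneg : 0 ≤ ∫ p : α × α, (w p.1 - w p.2) ^ 2 ∂μ.prod μ :=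
    integral_nonneg fun _ => sq_nonneg _
  linarith [integral_sq_sub_prod hw]

end Variance

section Grid

/-- The cell with index `z` of the cubic grid of mesh size `h` in `ℝ^N`. -/
def gridCell (h : ℝ) (z : Fin N → ℤ) : Set (E N) := {x | ∀ i, ⌊x i / h⌋ = z i}

theorem measurableSet_gridCell (h : ℝ) (z : Fin N → ℤ) : MeasurableSet (gridCell h z) := by
  have hfloor : ∀ i, Measurable fun x : E N => ⌊x i / h⌋ := fun i => by fun_prop
  rw [gridCell, Set.ofPred_forall]
  exact MeasurableSet.iInter fun i => hfloor i (measurableSet_singleton (z i))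

theorem pairwise_disjoint_gridCell (h : ℝ) :
    Pairwise (Function.onFun Disjoint (gridCell (N := N) h)) := fun _ _ hzz' =>
  Set.disjoint_left.2 fun _ hx hx' => hzz' (funext fun i => (hx i).symm.trans (hx' i))

theorem iUnion_gridCell (h : ℝ) : ⋃ z, gridCell (N := N) h z = Set.univ :=
  Set.eq_univ_of_forall fun x => Set.mem_iUnion.2 ⟨fun i => ⌊x i / h⌋, fun _ => rfl⟩

theorem mem_gridCell_iff {h : ℝ} (hh : 0 < h) {z : Fin N → ℤ} {x : E N} :
    x ∈ gridCell h z ↔ ∀ i, x i ∈ Set.Ico (z i * h) ((z i + 1) * h) := by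
  simp only [gridCell, Set.mem_ofPred_eq, Set.mem_Ico, Int.floor_eq_iff, le_div_iff₀ hh,
    div_lt_iff₀ hh]

theorem volume_gridCell {h : ℝ} (hh : 0 < h) (z : Fin N → ℤ) :
    volume (gridCell h z) = ENNReal.ofReal (h ^ N) := by
  have hpre : gridCell h z = (MeasurableEquiv.toLp 2 (Fin N → ℝ)).symm ⁻¹'
      (Set.univ.pi fun i => Set.Ico (z i * h) ((z i + 1) * h)) := by
    ext x
    rw [mem_gridCell_iff hh, Set.mem_preimage, Set.mem_univ_pi]
    rfl
  have hside : ∀ i, ((z i : ℝ) + 1) * h - z i * h = h := fun i => by ring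
  rw [hpre, (EuclideanSpace.volume_preserving_symm_measurableEquiv_toLp (Fin N)).measure_preimage
    (MeasurableSet.univ_pi fun i => measurableSet_Ico).nullMeasurableSet, Real.volume_pi_Ico]
  simp [hside, ENNReal.ofReal_pow hh.le]

theorem volume_real_gridCell {h : ℝ} (hh : 0 < h) (z : Fin N → ℤ) :
    volume.real (gridCell h z) = h ^ N := by
  rw [measureReal_def, volume_gridCell hh, ENNReal.toReal_ofReal (by positivity)]

theorem volume_gridCell_ne_top {h : ℝ} (hh : 0 < h) (z : Fin N → ℤ) :
    volume (gridCell h z) ≠ ∞ := by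
  rw [volume_gridCell hh]
  exact ENNReal.ofReal_ne_top

theorem norm_sub_le_of_mem_gridCell {h : ℝ} (hh : 0 < h) {z : Fin N → ℤ} {x y : E N}
    (hx : x ∈ gridCell h z) (hy : y ∈ gridCell h z) : ‖x - y‖ ≤ √N * h := by
  rw [mem_gridCell_iff hh] at hx hy
  have hcoord : ∀ i, ‖(x - y) i‖ ≤ h := fun i => by
    rw [PiLp.sub_apply, Real.norm_eq_abs, abs_le]
    constructor <;> linarith [(hx i).1, (hx i).2, (hy i).1, (hy i).2]
  rw [EuclideanSpace.norm_eq]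
  refine Real.sqrt_le_iff.2 ⟨by positivity, ?_⟩
  calc ∑ i, ‖(x - y) i‖ ^ 2 ≤ ∑ _i : Fin N, h ^ 2 := by gcongr with i; exact hcoord i
    _ = (√N * h) ^ 2 := by simp [mul_pow]

theorem exists_finset_volume_gridCell_inter_le (hΩ : volume Ω ≠ ∞) {h ε : ℝ} (hε : 0 < ε) :
    ∃ S : Finset (Fin N → ℤ), ∀ z ∉ S, volume.real (gridCell h z ∩ Ω) ≤ ε := by
  have hfin := Measure.finite_const_le_meas_of_disjoint_iUnion (volume.restrict Ω)
    (ENNReal.ofReal_pos.2 hε) (measurableSet_gridCell h) (pairwise_disjoint_gridCell h)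
    (by simpa [iUnion_gridCell])
  refine ⟨hfin.toFinset, fun z hz => ENNReal.toReal_le_of_le_ofReal hε.le ?_⟩
  rw [Set.Finite.mem_toFinset, Set.mem_ofPred_eq, not_le,
    Measure.restrict_apply (measurableSet_gridCell h z)] at hz
  exact hz.le

end Grid

section EnergyEstimate

theorem form_self (hK : IsCoerciveKernel K) (u : Lp ℝ 2 (volume : Measure (E N))) :
    form K u u = ∫ p, wdiff K u p ^ 2 := by
  refine integral_congr_ae ?_
  filter_upwards [hK.wdiff_mul_wdiff u u] with p hp
  rw [sq, ← hp, Pi.mul_apply]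

theorem sq_sub_le_mul_sq_wdiff (hK : IsCoerciveKernel K) {h M : ℝ} (hM : 0 < M)
    (hhM : ∀ x : E N, x ≠ 0 → ‖x‖ ≤ √N * h → M ≤ h ^ N * K x) (u : E N → ℝ) {p : E N × E N}
    (hp : ‖p.1 - p.2‖ ≤ √N * h) :
    (u p.1 - u p.2) ^ 2 ≤ h ^ N / M * wdiff K u p ^ 2 := by
  rcases eq_or_ne p.1 p.2 with heq | hne
  · simp [wdiff_apply, heq]
  · have hsub := sub_ne_zero.2 hne
    rw [wdiff_apply, mul_pow, Real.sq_sqrt (hK.pos hsub).le, div_mul_eq_mul_div, le_div_iff₀ hM,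
      mul_left_comm]
    exact mul_le_mul_of_nonneg_left (hhM _ hsub hp) (sq_nonneg _)

theorem setIntegral_gridCell_sq_le (hK : IsCoerciveKernel K) {h M : ℝ} (hh : 0 < h) (hM : 0 < M)
    (hhM : ∀ x : E N, x ≠ 0 → ‖x‖ ≤ √N * h → M ≤ h ^ N * K x)
    {u : Lp ℝ 2 (volume : Measure (E N))} (hu : u ∈ X K Ω) (z : Fin N → ℤ) :
    ∫ x in gridCell h z, u x ^ 2 ≤ (2 * M)⁻¹ * (∫ p in gridCell h z ×ˢ gridCell h z,
      wdiff K u p ^ 2) + (h ^ N)⁻¹ * (∫ x in gridCell h z, u x) ^ 2 := by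
  set Q := gridCell h z with hQ
  have hQm : MeasurableSet Q := measurableSet_gridCell h z
  have : IsFiniteMeasure (volume.restrict Q) :=
    isFiniteMeasure_restrict.2 (volume_gridCell_ne_top hh z)
  have hvar := integral_sq_sub_prod ((Lp.memLp u).restrict Q)
  have hint := integrable_sq_sub_prod ((Lp.memLp u).restrict Q)
  rw [Measure.prod_restrict, ← Measure.volume_eq_prod] at hvar hint
  rw [measureReal_restrict_apply_univ, hQ, volume_real_gridCell hh, ← hQ] at hvar
  have henergy : ∫ p in Q ×ˢ Q, (u p.1 - u p.2) ^ 2 ≤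
      h ^ N / M * ∫ p in Q ×ˢ Q, wdiff K u p ^ 2 := by
    rw [← integral_const_mul]
    exact setIntegral_mono_on hint
      ((hK.mem_X_iff.1 hu).1.integrable_sq.integrableOn.const_mul _) (hQm.prod hQm)
      fun p hp => sq_sub_le_mul_sq_wdiff hK hM hhM u (norm_sub_le_of_mem_gridCell hh hp.1 hp.2)
  have hhN : 0 < h ^ N := pow_pos hh N
  rw [hvar] at henergy
  field_simp at henergy ⊢
  linarith

theorem sq_setIntegral_gridCell_le {u : Lp ℝ 2 (volume : Measure (E N))} (hu : u ∈ X K Ω)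
    {h : ℝ} (hh : 0 < h) (z : Fin N → ℤ) : (∫ x in gridCell h z, u x) ^ 2 ≤
      volume.real (gridCell h z ∩ Ω) * ∫ x in gridCell h z, u x ^ 2 := by
  set Q := gridCell h z
  have hQm : MeasurableSet Q := measurableSet_gridCell h z
  have hfin : volume (Q ∩ Ω) ≠ ∞ := measure_ne_top_of_subset Set.inter_subset_left
    (volume_gridCell_ne_top hh z)
  have : IsFiniteMeasure (volume.restrict (Q ∩ Ω)) := isFiniteMeasure_restrict.2 hfin
  have hinter : ∫ x in Q, u x = ∫ x in Q ∩ Ω, u x := by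
    refine setIntegral_eq_of_subset_of_ae_sdiff_eq_zero hQm.nullMeasurableSet
      Set.inter_subset_left ?_
    filter_upwards [hu.2] with x hx hxQ
    exact hx fun hxΩ => hxQ.2 ⟨hxQ.1, hxΩ⟩
  calc (∫ x in Q, u x) ^ 2 ≤ volume.real (Q ∩ Ω) * ∫ x in Q ∩ Ω, u x ^ 2 := by
        rw [hinter, ← measureReal_restrict_apply_univ (μ := volume) (s := Q ∩ Ω)]
        exact sq_integral_le ((Lp.memLp u).restrict _)
    _ ≤ volume.real (Q ∩ Ω) * ∫ x in Q, u x ^ 2 :=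
      mul_le_mul_of_nonneg_left (setIntegral_mono_set (Lp.memLp u).integrable_sq.integrableOn
        (ae_of_all _ fun _ => sq_nonneg _) Set.inter_subset_left.eventuallyLE)
        measureReal_nonneg

theorem setIntegral_gridCell_sq_le_of_volume_le (hK : IsCoerciveKernel K) {h M : ℝ} (hh : 0 < h)
    (hM : 0 < M) (hhM : ∀ x : E N, x ≠ 0 → ‖x‖ ≤ √N * h → M ≤ h ^ N * K x)
    {u : Lp ℝ 2 (volume : Measure (E N))} (hu : u ∈ X K Ω) {z : Fin N → ℤ}
    (hz : volume.real (gridCell h z ∩ Ω) ≤ h ^ N / 2) :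
    ∫ x in gridCell h z, u x ^ 2 ≤
      M⁻¹ * ∫ p in gridCell h z ×ˢ gridCell h z, wdiff K u p ^ 2 := by
  have hcell := setIntegral_gridCell_sq_le hK hh hM hhM hu z
  have habsorb : (h ^ N)⁻¹ * (∫ x in gridCell h z, u x) ^ 2 ≤
      (∫ x in gridCell h z, u x ^ 2) / 2 := by
    rw [inv_mul_le_iff₀ (pow_pos hh N), ← mul_comm_div]
    exact (sq_setIntegral_gridCell_le hu hh z).trans
      (mul_le_mul_of_nonneg_right hz (integral_nonneg fun _ => sq_nonneg _))
  rw [mul_inv, mul_assoc] at hcell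
  linarith

theorem norm_sq_le_form_add_sum (hK : IsCoerciveKernel K) {h M : ℝ} (hh : 0 < h) (hM : 0 < M)
    (hhM : ∀ x : E N, x ≠ 0 → ‖x‖ ≤ √N * h → M ≤ h ^ N * K x) {S : Finset (Fin N → ℤ)}
    (hS : ∀ z ∉ S, volume.real (gridCell h z ∩ Ω) ≤ h ^ N / 2)
    {u : Lp ℝ 2 (volume : Measure (E N))} (hu : u ∈ X K Ω) :
    ‖u‖ ^ 2 ≤ M⁻¹ * form K u u + ∑ z ∈ S, (h ^ N)⁻¹ * (∫ x in gridCell h z, u x) ^ 2 := by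
  have hsq : Integrable (fun x => u x ^ 2) volume := (Lp.memLp u).integrable_sq
  have henergy : Integrable (fun p => wdiff K u p ^ 2) volume :=
    (hK.mem_X_iff.1 hu).1.integrable_sq
  set q : (Fin N → ℤ) → ℝ := fun z => (h ^ N)⁻¹ * (∫ x in gridCell h z, u x) ^ 2
  have hcell : ∀ z, ∫ x in gridCell h z, u x ^ 2 ≤
      M⁻¹ * (∫ p in gridCell h z ×ˢ gridCell h z, wdiff K u p ^ 2) + Set.indicator S q z := by
    intro z
    by_cases hz : z ∈ S
    · have hpos : 0 ≤ M⁻¹ * ∫ p in gridCell h z ×ˢ gridCell h z, wdiff K u p ^ 2 :=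
        mul_nonneg (inv_nonneg.2 hM.le) (integral_nonneg fun _ => sq_nonneg _)
      have hest := setIntegral_gridCell_sq_le hK hh hM hhM hu z
      rw [mul_inv, mul_assoc] at hest
      rw [Set.indicator_of_mem (Finset.mem_coe.2 hz)]
      linarith
    · rw [Set.indicator_of_notMem (Finset.mem_coe.not.2 hz), add_zero]
      exact setIntegral_gridCell_sq_le_of_volume_le hK hh hM hhM hu (hS z hz)
  have hsum := hasSum_integral_iUnion (measurableSet_gridCell h) (pairwise_disjoint_gridCell h)
    hsq.integrableOn
  have hsumE := hasSum_integral_iUnion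
    (fun z => (measurableSet_gridCell h z).prod (measurableSet_gridCell h z))
    (fun z z' hzz' => Set.disjoint_prod.2 (Or.inl (pairwise_disjoint_gridCell h hzz')))
    henergy.integrableOn
  have hsumS : HasSum (Set.indicator S q) (∑ z ∈ S, q z) :=
    hasSum_subtype_iff_indicator.1 (S.hasSum q)
  rw [iUnion_gridCell, setIntegral_univ, ← norm_sq_eq_integral] at hsum
  refine (hasSum_le hcell hsum ((hsumE.mul_left M⁻¹).add hsumS)).trans ?_
  gcongr
  rw [form_self hK]
  exact setIntegral_le_integral henergy (ae_of_all _ fun _ => sq_nonneg _)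

theorem exists_norm_sq_le_mul_form (hK : IsCoerciveKernel K) (hΩ : volume Ω ≠ ∞) :
    ∃ C : ℝ, ∀ u ∈ X K Ω, ‖u‖ ^ 2 ≤ C * form K u u := by
  obtain ⟨h, hh, hΩh⟩ : ∃ h : ℝ, 0 < h ∧ volume.real Ω ≤ h ^ N / 2 := by
    have := ((tendsto_pow_atTop hK.dim_pos.ne').atTop_div_const (two_pos (α := ℝ))
      ).eventually_ge_atTop (volume.real Ω)
    exact ((eventually_gt_atTop 0).and this).exists
  obtain ⟨c, hc, hcK⟩ := hK.lower_bound (√N * h)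
  have hhM : ∀ x : E N, x ≠ 0 → ‖x‖ ≤ √N * h → h ^ N * c ≤ h ^ N * K x := fun x hx hxh => by
    gcongr
    exact hcK x hx hxh
  refine ⟨(h ^ N * c)⁻¹, fun u hu => ?_⟩
  simpa using norm_sq_le_form_add_sum hK hh (by positivity) hhM (S := ∅)
    (fun z _ => (measureReal_mono Set.inter_subset_right hΩ).trans hΩh) hu

end EnergyEstimate

/-! ### The compact embedding into `L²` -/

section CompactnessCriterion

theorem isCompactOperator_of_norm_le_add {U V : Type*} [NormedAddCommGroup U] [NormedSpace ℝ U]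
    [NormedAddCommGroup V] [NormedSpace ℝ V] [CompleteSpace V] (T : U →L[ℝ] V)
    (h : ∀ ε : ℝ, 0 < ε → ∃ (W : Type*) (_ : NormedAddCommGroup W) (_ : NormedSpace ℝ W)
      (R : U →L[ℝ] W), IsCompactOperator R ∧ ∀ u, ‖T u‖ ≤ ε * ‖u‖ + ‖R u‖) :
    IsCompactOperator T := by
  have htb : TotallyBounded (T '' Metric.closedBall 0 1) := by
    refine Metric.totallyBounded_iff.2 fun ε hε => ?_
    obtain ⟨W, _, _, R, hR, hTR⟩ := h (ε / 4) (by positivity)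
    obtain ⟨C, hC, hRC⟩ := hR.image_closedBall_subset_compact (f := R.toLinearMap) 1
    obtain ⟨t, ht, htfin, hcover⟩ := (hC.totallyBounded.subset hRC).exists_subset
      (Metric.dist_mem_uniformity (half_pos hε))
    choose! y hy hyt using fun w (hw : w ∈ t) => ht hw
    refine ⟨(fun w => T (y w)) '' t, htfin.image _, ?_⟩
    rintro _ ⟨u, hu, rfl⟩
    obtain ⟨w, hwt, hw⟩ := Set.mem_iUnion₂.1 (hcover ⟨u, hu, rfl⟩)
    refine Set.mem_biUnion (Set.mem_image_of_mem _ hwt) ?_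
    have hdiff : ‖u - y w‖ ≤ 2 := (norm_sub_le _ _).trans
      (by linarith [mem_closedBall_zero_iff.1 hu, mem_closedBall_zero_iff.1 (hy w hwt)])
    have hsmall : ‖R (u - y w)‖ < ε / 2 := by
      rw [map_sub, ← dist_eq_norm]
      exact (hyt w hwt).symm ▸ hw
    rw [Metric.mem_ball, dist_eq_norm, ← map_sub]
    linarith [hTR (u - y w), mul_le_mul_of_nonneg_left hdiff (by positivity : 0 ≤ ε / 4)]
  exact (isCompactOperator_iff_image_closedBall_subset_compact T.toLinearMap one_pos).2
    ⟨_, isCompact_iff_totallyBounded_isComplete.2 ⟨htb.closure, isClosed_closure.isComplete⟩,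
     subset_closure⟩

end CompactnessCriterion

section HilbertSpace

variable (hK : IsCoerciveKernel K)

theorem norm_wdiffLp_sq (u : XSubmodule hK Ω) : ‖wdiffLp hK Ω u‖ ^ 2 = form K u u := by
  rw [← real_inner_self_eq_norm_sq, inner_wdiffLp]

theorem wdiffLp_injective (hΩ : volume Ω ≠ ∞) : Function.Injective (wdiffLp hK Ω) := by
  obtain ⟨C, hC⟩ := exists_norm_sq_le_mul_form hK hΩ
  refine (injective_iff_map_eq_zero _).2 fun u hu => ?_
  have hle := hC u u.2
  rw [← norm_wdiffLp_sq hK, hu, norm_zero, zero_pow two_ne_zero, mul_zero] at hle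
  simpa using le_antisymm hle (sq_nonneg _)

theorem exists_wdiffLp_eq_of_tendsto {u : ℕ → XSubmodule hK Ω}
    {z : Lp ℝ 2 (volume : Measure (E N))} {w : Lp ℝ 2 (volume : Measure (E N × E N))}
    (hz : Tendsto (fun n => (u n).1) atTop (𝓝 z))
    (hw : Tendsto (fun n => wdiffLp hK Ω (u n)) atTop (𝓝 w)) :
    ∃ hzX : z ∈ XSubmodule hK Ω, wdiffLp hK Ω ⟨z, hzX⟩ = w := by
  obtain ⟨n, hn, hzae⟩ := (tendstoInMeasure_of_tendsto_Lp hz).exists_seq_tendsto_ae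
  obtain ⟨k, hk, hwae⟩ := (tendstoInMeasure_of_tendsto_Lp
    (hw.comp hn.tendsto_atTop)).exists_seq_tendsto_ae
  have hwz : w =ᵐ[volume] wdiff K z := by
    have hwdiff : ∀ᵐ p, ∀ i, wdiffLp hK Ω (u i) p = wdiff K (u i).1 p :=
      ae_all_iff.2 fun i => coeFn_wdiffLp hK (u i)
    filter_upwards [hwae, hwdiff, Measure.quasiMeasurePreserving_fst.ae hzae,
      Measure.quasiMeasurePreserving_snd.ae hzae] with p hwp hup hfst hsnd
    have hlim := ((hfst.sub hsnd).mul_const √(K (p.1 - p.2))).comp hk.tendsto_atTop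
    exact tendsto_nhds_unique hwp (hlim.congr fun i => (hup _).symm)
  have hzX : z ∈ XSubmodule hK Ω := by
    refine hK.mem_X_iff.2 ⟨(memLp_congr_ae hwz).1 (Lp.memLp w), ?_⟩
    have hvanish : ∀ᵐ x : E N, ∀ i, x ∉ Ω → (u i).1 x = 0 := ae_all_iff.2 fun i => (u i).2.2
    filter_upwards [hzae, hvanish] with x hzx hux hx
    exact tendsto_nhds_unique hzx (tendsto_const_nhds.congr fun i => (hux _ hx).symm)
  exact ⟨hzX, Lp.ext ((coeFn_wdiffLp hK ⟨z, hzX⟩).trans hwz.symm)⟩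

/-- The Hilbert space `(X_K(Ω), ⟨·, ·⟩)`, realized inside `L²(ℝ^{2N})` through the weighted
difference; the function behind an element is recovered by `incl`. -/
abbrev XHilbert (hK : IsCoerciveKernel K) (Ω : Set (E N)) : Type :=
  LinearMap.range (wdiffLp hK Ω)

variable (hΩ : volume Ω ≠ ∞)

/-- The identification of `X_K(Ω)` with its Hilbert space realization. -/
noncomputable def xEquiv : XSubmodule hK Ω ≃ₗ[ℝ] XHilbert hK Ω :=
  LinearEquiv.ofInjective _ (wdiffLp_injective hK hΩ)

theorem coe_eq_wdiffLp (u : XHilbert hK Ω) : u.1 = wdiffLp hK Ω ((xEquiv hK hΩ).symm u) := by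
  conv_lhs => rw [← (xEquiv hK hΩ).apply_symm_apply u]
  rfl

/-- The continuous embedding of `X_K(Ω)` into `L²(ℝ^N)`. -/
noncomputable def incl : XHilbert hK Ω →L[ℝ] Lp ℝ 2 (volume : Measure (E N)) :=
  ((XSubmodule hK Ω).subtype ∘ₗ (xEquiv hK hΩ).symm.toLinearMap).mkContinuousOfExistsBound <| by
    obtain ⟨C, hC⟩ := exists_norm_sq_le_mul_form hK hΩ
    refine ⟨√C, fun u => ?_⟩
    have hle := hC _ ((xEquiv hK hΩ).symm u).2
    rw [← norm_wdiffLp_sq hK, ← coe_eq_wdiffLp] at hle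
    refine (Real.le_sqrt_of_sq_le hle).trans_eq ?_
    rw [Real.sqrt_mul' _ (sq_nonneg _), Real.sqrt_sq (norm_nonneg _), Submodule.coe_norm]

theorem incl_mem (u : XHilbert hK Ω) : incl hK hΩ u ∈ X K Ω := ((xEquiv hK hΩ).symm u).2

theorem exists_incl_eq {u : Lp ℝ 2 (volume : Measure (E N))} (hu : u ∈ X K Ω) :
    ∃ w : XHilbert hK Ω, incl hK hΩ w = u :=
  ⟨xEquiv hK hΩ ⟨u, hu⟩, congrArg Subtype.val ((xEquiv hK hΩ).symm_apply_apply ⟨u, hu⟩)⟩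

theorem incl_injective : Function.Injective (incl hK hΩ) :=
  Subtype.val_injective.comp (xEquiv hK hΩ).symm.injective

theorem inner_eq_form (u v : XHilbert hK Ω) : ⟪u, v⟫_ℝ = form K (incl hK hΩ u) (incl hK hΩ v) := by
  rw [Submodule.coe_inner, coe_eq_wdiffLp hK hΩ u, coe_eq_wdiffLp hK hΩ v, inner_wdiffLp]
  rfl

theorem norm_sq_eq_form (u : XHilbert hK Ω) :
    ‖u‖ ^ 2 = form K (incl hK hΩ u) (incl hK hΩ u) := by
  rw [← real_inner_self_eq_norm_sq, inner_eq_form]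

include hΩ in
theorem completeSpace_xHilbert : CompleteSpace (XHilbert hK Ω) := by
  refine Metric.complete_of_cauchySeq_tendsto fun u hu => ?_
  obtain ⟨z, hz⟩ := cauchySeq_tendsto_of_complete
    ((incl hK hΩ).uniformContinuous.comp_cauchySeq hu)
  obtain ⟨w, hw⟩ := cauchySeq_tendsto_of_complete (uniformContinuous_subtype_val.comp_cauchySeq hu)
  obtain ⟨hzX, rfl⟩ := exists_wdiffLp_eq_of_tendsto hK hz
    (hw.congr fun n => coe_eq_wdiffLp hK hΩ (u n))
  exact ⟨⟨_, LinearMap.mem_range_self _ _⟩, tendsto_subtype_rng.2 hw⟩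

/-- The scaled mean values `(h ^ N)^{-1/2} ∫ u` over the cells indexed by `S`. -/
noncomputable def cellMeans {h : ℝ} (hh : 0 < h) (S : Finset (Fin N → ℤ)) :
    Lp ℝ 2 (volume : Measure (E N)) →L[ℝ] EuclideanSpace ℝ S :=
  (EuclideanSpace.equiv S ℝ).symm.toContinuousLinearMap ∘L ContinuousLinearMap.pi fun z =>
    (√(h ^ N))⁻¹ • innerSL ℝ (indicatorConstLp 2 (measurableSet_gridCell h z.1)
      (volume_gridCell_ne_top hh z.1) (1 : ℝ))

theorem norm_cellMeans_sq {h : ℝ} (hh : 0 < h) (S : Finset (Fin N → ℤ))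
    (u : Lp ℝ 2 (volume : Measure (E N))) : ‖cellMeans hh S u‖ ^ 2 =
      ∑ z ∈ S, (h ^ N)⁻¹ * (∫ x in gridCell h z, u x) ^ 2 := by
  have hcoord : ∀ z : S, cellMeans hh S u z = (√(h ^ N))⁻¹ * ∫ x in gridCell h z.1, u x :=
    fun z => congrArg ((√(h ^ N))⁻¹ * ·) (L2.inner_indicatorConstLp_one _ _ u)
  rw [EuclideanSpace.norm_sq_eq, ← Finset.sum_coe_sort S]
  refine Finset.sum_congr rfl fun z _ => ?_
  rw [hcoord, Real.norm_eq_abs, sq_abs, mul_pow, inv_pow, Real.sq_sqrt (pow_pos hh N).le]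

theorem isCompactOperator_incl : IsCompactOperator (incl hK hΩ) := by
  refine isCompactOperator_of_norm_le_add _ fun ε hε => ?_
  obtain ⟨h, hh, hhM⟩ := hK.exists_forall_le_pow_mul (ε ^ 2)⁻¹
  obtain ⟨S, hS⟩ := exists_finset_volume_gridCell_inter_le hΩ (h := h) (half_pos (pow_pos hh N))
  refine ⟨_, _, _, cellMeans hh S ∘L incl hK hΩ,
    isCompactOperator_of_locallyCompactSpace_dom _, fun u => ?_⟩
  have hest := norm_sq_le_form_add_sum hK hh (by positivity) hhM hS (incl_mem hK hΩ u)
  rw [inv_inv, ← norm_sq_eq_form, ← norm_cellMeans_sq hh] at hest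
  refine le_of_sq_le_sq ?_ (by positivity)
  rw [ContinuousLinearMap.comp_apply]
  nlinarith [mul_nonneg (mul_nonneg hε.le (norm_nonneg u))
    (norm_nonneg (cellMeans hh S (incl hK hΩ u)))]

end HilbertSpace

/-! ### The form of a weight -/

section WeightPairing

variable {α : Type*} [MeasurableSpace α] {μ : Measure α}

/-- The bilinear form `(f, g) ↦ ∫ ρ f g` on `L²(μ)`. -/
noncomputable def weightPairing (ρ : Lp ℝ ∞ μ) : Lp ℝ 2 μ →L[ℝ] Lp ℝ 2 μ →L[ℝ] ℝ :=
  (ContinuousLinearMap.mul ℝ ℝ).lpPairing μ 2 2 ∘L (ContinuousLinearMap.mul ℝ ℝ).holderL μ ∞ 2 2 ρ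

theorem weightPairing_apply (ρ : Lp ℝ ∞ μ) (f g : Lp ℝ 2 μ) :
    weightPairing ρ f g = ∫ x, ρ x * (f x * g x) ∂μ := by
  rw [weightPairing, ContinuousLinearMap.comp_apply, ContinuousLinearMap.lpPairing_eq_integral]
  refine integral_congr_ae ?_
  filter_upwards [(ContinuousLinearMap.mul ℝ ℝ).coeFn_holder (r := 2) ρ f] with x hx
  rw [ContinuousLinearMap.holderL_apply_apply, hx]
  exact mul_assoc _ _ _

theorem weightPairing_sub (ρ ρ' : Lp ℝ ∞ μ) (f g : Lp ℝ 2 μ) :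
    weightPairing (ρ - ρ') f g = weightPairing ρ f g - weightPairing ρ' f g := by
  simp only [weightPairing, map_sub, ContinuousLinearMap.comp_sub, sub_apply]

theorem integrable_weight (ρ : Lp ℝ ∞ μ) (f g : Lp ℝ 2 μ) :
    Integrable (fun x => ρ x * (f x * g x)) μ :=
  memLp_one_iff_integrable.1 <|
    ((Lp.memLp g).mul (r := 1) (Lp.memLp f)).mul (p := ∞) (Lp.memLp ρ)

variable {ρ : Lp ℝ ∞ μ}

theorem weightPairing_self_nonneg (hρ : 0 ≤ ρ) (f : Lp ℝ 2 μ) : 0 ≤ weightPairing ρ f f := by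
  rw [weightPairing_apply]
  refine integral_nonneg_of_ae ?_
  filter_upwards [(Lp.coeFn_nonneg ρ).2 hρ] with x hx using mul_nonneg hx (mul_self_nonneg _)

theorem weightPairing_self_pos (hρ : 0 ≤ ρ) (hρ0 : ρ ≠ 0) {f : Lp ℝ 2 μ} (hf : ∀ᵐ x ∂μ, f x ≠ 0) :
    0 < weightPairing ρ f f := by
  refine (weightPairing_self_nonneg hρ f).lt_of_ne' fun hzero => hρ0 ?_
  rw [weightPairing_apply, integral_eq_zero_iff_of_nonneg_ae ?_ (integrable_weight ρ f f)] at hzero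
  · refine Lp.ext ?_
    filter_upwards [hzero, hf, Lp.coeFn_zero ℝ ∞ μ] with x hx hfx h0
    rw [h0]
    exact (mul_eq_zero.1 hx).resolve_right (mul_self_ne_zero.2 hfx)
  · filter_upwards [(Lp.coeFn_nonneg ρ).2 hρ] with x hx using mul_nonneg hx (mul_self_nonneg _)

end WeightPairing

section WeightForm

variable (hK : IsCoerciveKernel K) (hΩ : volume Ω ≠ ∞) (ρ ρ' : Lp ℝ ∞ (volume.restrict Ω))

/-- The compact restriction map from `X_K(Ω)` to `L²(Ω)`. -/
noncomputable def inclRestrict : XHilbert hK Ω →L[ℝ] Lp ℝ 2 (volume.restrict Ω) :=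
  LpToLpRestrictCLM (E N) ℝ ℝ volume 2 Ω ∘L incl hK hΩ

theorem coeFn_inclRestrict (u : XHilbert hK Ω) :
    inclRestrict hK hΩ u =ᵐ[volume.restrict Ω] incl hK hΩ u :=
  LpToLpRestrictCLM_coeFn ℝ Ω (incl hK hΩ u)

/-- The form `(u, v) ↦ ∫_Ω ρ u v` on `X_K(Ω)`. -/
noncomputable def weightForm : XHilbert hK Ω →L[ℝ] XHilbert hK Ω →L[ℝ] ℝ :=
  (weightPairing ρ).bilinearComp (inclRestrict hK hΩ) (inclRestrict hK hΩ)

theorem isCompactOperator_weightForm : IsCompactOperator (weightForm hK hΩ ρ) :=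
  (isCompactOperator_incl hK hΩ).clm_comp <|
    ContinuousLinearMap.precomp ℝ (inclRestrict hK hΩ) ∘L weightPairing ρ ∘L
      LpToLpRestrictCLM (E N) ℝ ℝ volume 2 Ω

theorem weightForm_eq_integral {u v : XHilbert hK Ω} {f g : E N → ℝ}
    (hu : incl hK hΩ u =ᵐ[volume] f) (hv : incl hK hΩ v =ᵐ[volume] g) :
    weightForm hK hΩ ρ u v = ∫ x in Ω, ρ x * (f x * g x) := by
  rw [weightForm, ContinuousLinearMap.bilinearComp_apply, weightPairing_apply]
  refine integral_congr_ae ?_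
  filter_upwards [coeFn_inclRestrict hK hΩ u, coeFn_inclRestrict hK hΩ v, ae_restrict_of_ae hu,
    ae_restrict_of_ae hv] with x hux hvx huf hvg
  rw [hux, hvx, huf, hvg]

theorem weightForm_apply (u v : XHilbert hK Ω) :
    weightForm hK hΩ ρ u v = ∫ x in Ω, ρ x * (incl hK hΩ u x * incl hK hΩ v x) :=
  weightForm_eq_integral hK hΩ ρ (ae_eq_refl _) (ae_eq_refl _)

theorem weightForm_symm (u v : XHilbert hK Ω) :
    weightForm hK hΩ ρ u v = weightForm hK hΩ ρ v u := by
  simp only [weightForm_apply, mul_comm (incl hK hΩ u _)]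

theorem weightForm_sub (u v : XHilbert hK Ω) :
    weightForm hK hΩ (ρ' - ρ) u v = weightForm hK hΩ ρ' u v - weightForm hK hΩ ρ u v :=
  weightPairing_sub _ _ _ _

variable {ρ ρ'}

theorem weightForm_self_mono (hle : ρ ≤ ρ') (u : XHilbert hK Ω) :
    weightForm hK hΩ ρ u u ≤ weightForm hK hΩ ρ' u u := by
  rw [← sub_nonneg, ← weightForm_sub]
  exact weightPairing_self_nonneg (sub_nonneg.2 hle) _

theorem weightForm_self_lt (hΩm : MeasurableSet Ω) (hle : ρ ≤ ρ') (hne : ρ ≠ ρ')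
    {u : XHilbert hK Ω} (hu : volume {x ∈ Ω | incl hK hΩ u x = 0} = 0) :
    weightForm hK hΩ ρ u u < weightForm hK hΩ ρ' u u := by
  rw [← sub_pos, ← weightForm_sub]
  refine weightPairing_self_pos (f := inclRestrict hK hΩ u) (sub_nonneg.2 hle)
    (sub_ne_zero.2 hne.symm) ?_
  filter_upwards [coeFn_inclRestrict hK hΩ u, ae_restrict_mem hΩm,
    ae_restrict_of_ae (measure_eq_zero_iff_ae_notMem.1 hu)] with x hx hxΩ hx0
  rw [hx]
  exact fun h => hx0 ⟨hxΩ, h⟩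

theorem isEigenfunction_of_isFormEigen {m : ℝ} (hm : m ≠ 0) {u : XHilbert hK Ω} (hu0 : u ≠ 0)
    (hu : IsFormEigen (weightForm hK hΩ ρ) m u) : IsEigenfunction K Ω ρ m⁻¹ (incl hK hΩ u) := by
  refine ⟨incl_mem hK hΩ u, (map_ne_zero_iff _ (incl_injective hK hΩ)).2 hu0, fun v hv => ?_⟩
  obtain ⟨v, rfl⟩ := exists_incl_eq hK hΩ hv
  rw [← weightForm_apply, hu v, inner_eq_form hK hΩ, inv_mul_cancel_left₀ hm]

end WeightForm

/-! ### Subspaces on which the form of a weight is positive -/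

section PositiveSubspace

theorem hasPositiveSubspace_of_orthogonal {H : Type*} [NormedAddCommGroup H]
    [InnerProductSpace ℝ H] {b : H →L[ℝ] H →L[ℝ] ℝ} {j : ℕ} (f : Fin j → H)
    (horth : Pairwise fun i i' => b (f i) (f i') = 0) (hpos : ∀ i, 0 < b (f i) (f i)) :
    HasPositiveSubspace b j := by
  have hexpand : ∀ c : Fin j → ℝ,
      b (∑ i, c i • f i) (∑ i, c i • f i) = ∑ i, c i ^ 2 * b (f i) (f i) := fun c => by
    simp only [map_sum, map_smul, sum_apply, smul_apply, smul_eq_mul]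
    refine Finset.sum_congr rfl fun i _ => ?_
    rw [Finset.sum_eq_single i (fun i' _ hi' => by rw [horth hi', mul_zero]) (by simp)]
    ring
  have hpos' : ∀ c : Fin j → ℝ, c ≠ 0 → 0 < b (∑ i, c i • f i) (∑ i, c i • f i) := fun c hc => by
    obtain ⟨i, hi⟩ := Function.ne_iff.1 hc
    rw [hexpand]
    exact Finset.sum_pos' (fun k _ => mul_nonneg (sq_nonneg _) (hpos k).le)
      ⟨i, Finset.mem_univ i, mul_pos (pow_two_pos_of_ne_zero hi) (hpos i)⟩
  have hli : LinearIndependent ℝ f := Fintype.linearIndependent_iff.2 fun c hc => by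
    by_contra! hne
    have := hpos' c (Function.ne_iff.2 hne)
    simp [hc] at this
  refine ⟨Submodule.span ℝ (Set.range f), by simpa using finrank_span_eq_card hli, ?_⟩
  intro u hu hu0
  obtain ⟨c, rfl⟩ := (Submodule.mem_span_range_iff_exists_fun ℝ).1 hu
  exact hpos' c fun hc => hu0 (by simp [hc])

theorem exists_pairwise_disjoint_isOpen {α : Type*} [TopologicalSpace α] [T2Space α]
    [HereditarilyLindelofSpace α] [MeasurableSpace α] {μ : Measure α} [NullSingletonClass μ]
    (hμ : μ ≠ 0) (j : ℕ) : ∃ U : Fin j → Set α, (∀ i, IsOpen (U i)) ∧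
      Pairwise (Function.onFun Disjoint U) ∧ ∀ i, μ (U i) ≠ 0 := by
  have hinf : μ.support.Infinite := fun hfin => hμ <| Measure.measure_univ_eq_zero.1 <| by
    rw [← Set.union_compl_self μ.support]
    exact measure_union_null (hfin.measure_zero μ) Measure.measure_compl_support
  have := hinf.to_subtype
  let x : Fin j ↪ α := (Fin.valEmbedding.trans (Infinite.natEmbedding μ.support)).trans
    (Function.Embedding.subtype _)
  obtain ⟨U, hU, hdisj⟩ := (Set.finite_range x).t2_separation
  refine ⟨U ∘ x, fun i => (hU _).2, fun i i' hne => ?_, fun i => ?_⟩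
  · exact hdisj (Set.mem_range_self i) (Set.mem_range_self i') (x.injective.ne hne)
  · have hx : x i ∈ μ.support := (Infinite.natEmbedding μ.support i).2
    exact ((Measure.mem_support_iff_forall _).1 hx _ ((hU _).2.mem_nhds (hU _).1)).ne'

theorem tendsto_integral_mul_thickenedIndicator_sq {α : Type*} [PseudoEMetricSpace α]
    [MeasurableSpace α] [BorelSpace α] {μ : Measure α} {ρ : α → ℝ} (hρ : Integrable ρ μ) {C : Set α}
    (hC : IsClosed C) {δ : ℕ → ℝ} (hδ : ∀ n, 0 < δ n) (hδ0 : Tendsto δ atTop (𝓝 0)) :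
    Tendsto (fun n => ∫ x, ρ x * (thickenedIndicator (hδ n) C x : ℝ) ^ 2 ∂μ) atTop
      (𝓝 (∫ x in C, ρ x ∂μ)) := by
  rw [← integral_indicator hC.measurableSet]
  refine tendsto_integral_of_dominated_convergence (fun x => ‖ρ x‖) (fun n => ?_) hρ.norm
    (fun n => .of_forall fun x => ?_) (.of_forall fun x => ?_)
  · have := (thickenedIndicator (hδ n) C).continuous
    exact hρ.aestronglyMeasurable.mul (Continuous.aestronglyMeasurable (by fun_prop))
  · rw [norm_mul, norm_pow, NNReal.norm_eq]
    exact mul_le_of_le_one_right (norm_nonneg _)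
      (pow_le_one₀ NNReal.zero_le_coe (thickenedIndicator_le_one (hδ n) C x))
  · have hlim := tendsto_pi_nhds.1 (thickenedIndicator_tendsto_indicator_closure hδ hδ0 C) x
    refine (((NNReal.continuous_coe.tendsto _).comp hlim).pow 2 |>.const_mul (ρ x)).trans_eq ?_
    rw [hC.closure_eq]
    by_cases hx : x ∈ C <;> simp [hx]

theorem exists_lipschitz_bump {α : Type*} [MetricSpace α] [MeasurableSpace α] [BorelSpace α]
    {μ : Measure α} [IsFiniteMeasure μ] [μ.InnerRegularCompactLTTop] {ρ : α → ℝ}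
    (hρ : Integrable ρ μ) (hρm : Measurable ρ) {U : Set α} (hU : IsOpen U)
    (hpos : μ (U ∩ {x | 0 < ρ x}) ≠ 0) :
    ∃ (L : NNReal) (f : α → ℝ), LipschitzWith L f ∧ (∀ x, |f x| ≤ 1) ∧ Function.support f ⊆ U ∧
      0 < ∫ x, ρ x * f x ^ 2 ∂μ := by
  obtain ⟨C, hCU, hC, hC0⟩ := (hU.measurableSet.inter
    (measurableSet_lt measurable_const hρm)).exists_lt_isCompact (pos_iff_ne_zero.2 hpos)
  have hCpos : 0 < ∫ x in C, ρ x ∂μ := by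
    refine (setIntegral_pos_iff_support_of_nonneg_ae ?_ hρ.integrableOn).2 ?_
    · filter_upwards [ae_restrict_mem hC.measurableSet] with x hx using (hCU hx).2.le
    · have hsupp : C ⊆ Function.support ρ := fun x hx => (hCU hx).2.ne'
      rwa [Set.inter_eq_right.2 hsupp]
  obtain ⟨ε, hε, hεU⟩ := hC.exists_thickening_subset_open hU fun x hx => (hCU hx).1
  have hδ : ∀ n : ℕ, (0 : ℝ) < 1 / ((n : ℝ) + 1) := fun n => Nat.one_div_pos_of_nat
  have hδ0 := tendsto_one_div_add_atTop_nhds_zero_nat (𝕜 := ℝ)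
  obtain ⟨n, hn, hnε⟩ := (((tendsto_integral_mul_thickenedIndicator_sq hρ hC.isClosed hδ
    hδ0).eventually_const_lt hCpos).and (hδ0.eventually_lt_const hε)).exists
  refine ⟨_, fun x => thickenedIndicator (hδ n) C x, lipschitzWith_thickenedIndicator (hδ n) C,
    fun x => ?_, fun x hx => hεU (Metric.thickening_mono hnε.le C ?_), hn⟩
  · rw [NNReal.abs_eq]
    exact thickenedIndicator_le_one (hδ n) C x
  · by_contra hxC
    exact hx (congrArg NNReal.toReal (thickenedIndicator_zero (hδ n) C hxC))

end PositiveSubspace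

section LipschitzFunctions

variable {L : NNReal} {f : E N → ℝ}

theorem sq_sub_le_mul_min (hL : LipschitzWith L f) (hf1 : ∀ x, |f x| ≤ 1) (x y : E N) :
    (f x - f y) ^ 2 ≤ ((L : ℝ) ^ 2 + 4) * min (‖x - y‖ ^ 2) 1 := by
  have hlip : |f x - f y| ≤ L * ‖x - y‖ := by
    simpa only [dist_eq_norm, Real.norm_eq_abs] using hL.dist_le_mul x y
  have hbdd : |f x - f y| ≤ 2 := (abs_sub _ _).trans (by linarith [hf1 x, hf1 y])
  rw [← sq_abs, mul_min_of_nonneg _ _ (by positivity)]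
  refine le_min ?_ ?_
  · nlinarith [pow_le_pow_left₀ (abs_nonneg _) hlip 2, sq_nonneg ‖x - y‖]
  · nlinarith [pow_le_pow_left₀ (abs_nonneg _) hbdd 2, sq_nonneg (L : ℝ)]

theorem sq_sub_le_mul_indicator_add (hL : LipschitzWith L f) (hf1 : ∀ x, |f x| ≤ 1) (x y : E N) :
    (f x - f y) ^ 2 ≤ ((L : ℝ) ^ 2 + 4) * (((Function.support f).indicator 1 x +
      (Function.support f).indicator 1 y) * min (‖x - y‖ ^ 2) 1) := by
  rcases eq_or_ne (f x) (f y) with hxy | hxy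
  · have hind : ∀ z, 0 ≤ (Function.support f).indicator (1 : E N → ℝ) z :=
      Set.indicator_nonneg fun _ _ => zero_le_one
    rw [hxy, sub_self, zero_pow two_ne_zero]
    exact mul_nonneg (by positivity) (mul_nonneg (add_nonneg (hind x) (hind y)) (by positivity))
  · have hone : 1 ≤ (Function.support f).indicator (1 : E N → ℝ) x +
        (Function.support f).indicator 1 y := by
      by_cases hx : f x = 0 <;> by_cases hy : f y = 0 <;> simp_all
    exact (sq_sub_le_mul_min hL hf1 x y).trans <| mul_le_mul_of_nonneg_left
      (le_mul_of_one_le_left (by positivity) hone) (by positivity)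

theorem IsCoerciveKernel.integrable_indicator_mul_add (hK : IsCoerciveKernel K) {S : Set (E N)}
    (hSm : MeasurableSet S) (hS : volume S ≠ ∞) :
    Integrable fun p : E N × E N => (S.indicator 1 p.1 + S.indicator 1 p.2) *
      (min (‖p.1 - p.2‖ ^ 2) 1 * K (p.1 - p.2)) := by
  have hind : Integrable (S.indicator (1 : E N → ℝ)) :=
    (integrable_indicator_iff hSm).2 (integrableOn_const hS)
  have hfst := (hind.convolution_integrand (ContinuousLinearMap.mul ℝ ℝ)
    hK.integrable.comp_neg).swap
  have hsnd := hind.convolution_integrand (ContinuousLinearMap.mul ℝ ℝ) hK.integrable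
  refine (hfst.add hsnd).congr (.of_forall fun p => ?_)
  simp only [Pi.add_apply, Function.comp_apply, Prod.fst_swap, Prod.snd_swap, neg_sub,
    ContinuousLinearMap.mul_apply', add_mul]

theorem IsCoerciveKernel.memLp_wdiff_of_lipschitzWith (hK : IsCoerciveKernel K)
    (hL : LipschitzWith L f) (hf1 : ∀ x, |f x| ≤ 1) (hf : volume (Function.support f) ≠ ∞) :
    MemLp (wdiff K f) 2 volume := by
  have hcont := hL.continuous
  have hfm : AEStronglyMeasurable f volume := hcont.aestronglyMeasurable
  rw [hK.memLp_wdiff_iff hfm]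
  refine ((hK.integrable_indicator_mul_add hcont.isOpen_support.measurableSet hf).const_mul
    ((L : ℝ) ^ 2 + 4)).mono' ?_ ?_
  · refine ((hK.aestronglyMeasurable_wdiff hfm).pow 2).congr ?_
    filter_upwards [hK.wdiff_mul_wdiff f f] with p hp
    rw [Pi.pow_apply, sq, sq, ← hp, Pi.mul_apply]
  · filter_upwards [hK.ae_ne_fst_snd] with p hp
    have hKp := hK.pos (sub_ne_zero.2 hp)
    rw [Real.norm_of_nonneg (by positivity), ← mul_assoc _ _ (K _), ← mul_assoc _ _ (K _)]
    exact mul_le_mul_of_nonneg_right (sq_sub_le_mul_indicator_add hL hf1 p.1 p.2) hKp.le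

theorem exists_incl_ae_eq_of_lipschitzWith (hK : IsCoerciveKernel K) (hΩ : volume Ω ≠ ∞)
    (hL : LipschitzWith L f) (hf1 : ∀ x, |f x| ≤ 1) (hfΩ : Function.support f ⊆ Ω) :
    ∃ u : XHilbert hK Ω, incl hK hΩ u =ᵐ[volume] f := by
  have hsupp : volume (Function.support f) ≠ ∞ := measure_ne_top_of_subset hfΩ hΩ
  have hmem : MemLp f 2 volume :=
    (memLp_top_of_bound hL.continuous.aestronglyMeasurable 1
      (.of_forall hf1)).mono_exponent_of_measure_support_ne_top
      (fun _ => Function.notMem_support.1) hsupp le_top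
  have hae := hmem.coeFn_toLp
  have hX : hmem.toLp f ∈ X K Ω := by
    refine hK.mem_X_iff.2 ⟨(memLp_congr_ae (wdiff_ae_congr hae)).2
      (hK.memLp_wdiff_of_lipschitzWith hL hf1 hsupp), ?_⟩
    filter_upwards [hae] with x hx hxΩ
    rw [hx]
    exact Function.notMem_support.1 fun h => hxΩ (hfΩ h)
  obtain ⟨u, hu⟩ := exists_incl_eq hK hΩ hX
  exact ⟨u, hu ▸ hae⟩

end LipschitzFunctions

section PositiveWeight

theorem measure_setOf_pos_ne_zero {α : Type*} [MeasurableSpace α] {μ : Measure α}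
    {ρ : Lp ℝ ∞ μ} (hρ : ρ⁺ ≠ 0) : μ {x | 0 < ρ x} ≠ 0 := by
  refine fun hzero => hρ (posPart_eq_zero.2 ((Lp.coeFn_le ρ 0).1 ?_))
  filter_upwards [measure_eq_zero_iff_ae_notMem.1 hzero, Lp.coeFn_zero ℝ ∞ μ] with x hx h0
  rw [h0]
  exact not_lt.1 hx

theorem hasPositiveSubspace_weightForm (hK : IsCoerciveKernel K) (hΩ_open : IsOpen Ω)
    (hΩ : volume Ω ≠ ∞) {ρ : Lp ℝ ∞ (volume.restrict Ω)} (hρ : ρ⁺ ≠ 0) (j : ℕ) :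
    HasPositiveSubspace (weightForm hK hΩ ρ) j := by
  have := hK.nontrivial
  have : IsFiniteMeasure (volume.restrict Ω) := isFiniteMeasure_restrict.2 hΩ
  have hρi : Integrable ρ (volume.restrict Ω) := (Lp.memLp ρ).integrable le_top
  have hρm : Measurable ρ := (Lp.stronglyMeasurable ρ).measurable
  obtain ⟨U, hU, hdisj, hU0⟩ := exists_pairwise_disjoint_isOpen
    (Measure.restrict_eq_zero.not.2 (measure_setOf_pos_ne_zero hρ)) j
  have hUΩ : ∀ i, volume.restrict Ω ((U i ∩ Ω) ∩ {x | 0 < ρ x}) ≠ 0 := fun i => by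
    have hUi := hU0 i
    rw [Measure.restrict_apply (hU i).measurableSet,
      Measure.restrict_apply' hΩ_open.measurableSet] at hUi
    rwa [Measure.restrict_apply' hΩ_open.measurableSet, Set.inter_right_comm (U i),
      Set.inter_assoc, Set.inter_self]
  choose L f hL hf1 hfU hpos using fun i =>
    exists_lipschitz_bump hρi hρm ((hU i).inter hΩ_open) (hUΩ i)
  choose u hu using fun i => exists_incl_ae_eq_of_lipschitzWith hK hΩ (hL i) (hf1 i)
    ((hfU i).trans Set.inter_subset_right)
  refine hasPositiveSubspace_of_orthogonal u (fun i i' hne => ?_) fun i => ?_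
  · have hprod : ∀ x, f i x * f i' x = 0 := fun x => by
      by_contra hx
      exact (hdisj hne).notMem_of_mem_left (hfU i (left_ne_zero_of_mul hx)).1
        (hfU i' (right_ne_zero_of_mul hx)).1
    simp only [weightForm_eq_integral hK hΩ ρ (hu i) (hu i'), hprod, mul_zero, integral_zero]
  · simpa only [weightForm_eq_integral hK hΩ ρ (hu i) (hu i), ← sq] using hpos i

end PositiveWeight

/-! ### Variational eigenvalues -/

section Eigenvalues

theorem minimaxValue_weightForm_pos (hK : IsCoerciveKernel K) (hΩ_open : IsOpen Ω)
    (hΩ : volume Ω ≠ ∞) {ρ : Lp ℝ ∞ (volume.restrict Ω)} (hρ : ρ⁺ ≠ 0) {j : ℕ} (hj : 0 < j) :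
    0 < minimaxValue (weightForm hK hΩ ρ) j :=
  have := completeSpace_xHilbert hK hΩ
  minimaxValue_pos (isCompactOperator_weightForm hK hΩ ρ) (weightForm_symm hK hΩ ρ) hj
    (hasPositiveSubspace_weightForm hK hΩ_open hΩ hρ j)

theorem minimaxValue_weightForm_lt (hK : IsCoerciveKernel K) (hΩ_open : IsOpen Ω)
    (hΩ : volume Ω ≠ ∞) {ρ ρ' : Lp ℝ ∞ (volume.restrict Ω)} (hle : ρ ≤ ρ') (hne : ρ ≠ ρ')
    (hucp : UCP K Ω ρ ∨ UCP K Ω ρ') (hρ : ρ⁺ ≠ 0) {j : ℕ} (hj : 0 < j) :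
    minimaxValue (weightForm hK hΩ ρ) j < minimaxValue (weightForm hK hΩ ρ') j := by
  have := completeSpace_xHilbert hK hΩ
  refine minimaxValue_lt (isCompactOperator_weightForm hK hΩ ρ)
    (isCompactOperator_weightForm hK hΩ ρ') (weightForm_symm hK hΩ ρ) (weightForm_symm hK hΩ ρ') hj
    (hasPositiveSubspace_weightForm hK hΩ_open hΩ hρ j) (weightForm_self_mono hK hΩ hle)
    fun m u hm hu0 hu hu' => ?_
  refine weightForm_self_lt hK hΩ hΩ_open.measurableSet hle hne ?_
  rcases hucp with hucp | hucp
  · exact hucp _ _ (isEigenfunction_of_isFormEigen hK hΩ hm.ne' hu0 hu)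
  · exact hucp _ _ (isEigenfunction_of_isFormEigen hK hΩ hm.ne' hu0 hu')

section MinimaxTransfer

variable (hK : IsCoerciveKernel K) (hΩ : volume Ω ≠ ∞)

theorem finrank_map_incl (G : Submodule ℝ (XHilbert hK Ω)) :
    Module.finrank ℝ (G.map (incl hK hΩ).toLinearMap) = Module.finrank ℝ G :=
  (Submodule.equivMapOfInjective _ (incl_injective hK hΩ) G).finrank_eq.symm

/-- The subspace of `L²(ℝ^N)` underlying a `j`-dimensional subspace of the Hilbert space
`XHilbert hK Ω`. -/
noncomputable def mapIncl {j : ℕ}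
    (G : {G : Submodule ℝ (XHilbert hK Ω) // Module.finrank ℝ G = j}) : Subspaces K Ω j :=
  ⟨G.1.map (incl hK hΩ).toLinearMap, by
    rintro _ ⟨u, -, rfl⟩
    exact incl_mem hK hΩ u, (finrank_map_incl hK hΩ G.1).trans G.2⟩

theorem mapIncl_surjective (j : ℕ) : Function.Surjective (mapIncl hK hΩ (j := j)) := by
  rintro ⟨F, hF, hFj⟩
  have hmap : (F.comap (incl hK hΩ).toLinearMap).map (incl hK hΩ).toLinearMap = F :=
    Submodule.map_comap_eq_of_le fun u hu => exists_incl_eq hK hΩ (hF hu)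
  refine ⟨⟨F.comap (incl hK hΩ).toLinearMap, ?_⟩, Subtype.ext hmap⟩
  rw [← finrank_map_incl hK hΩ, hmap, hFj]

theorem iInf_sphere_mapIncl (ρ : Lp ℝ ∞ (volume.restrict Ω)) {j : ℕ}
    (G : {G : Submodule ℝ (XHilbert hK Ω) // Module.finrank ℝ G = j}) :
    ⨅ u : sphere K (mapIncl hK hΩ G).1, ∫ x in Ω, ρ x * u.1 x ^ 2 =
      ⨅ u : {u : XHilbert hK Ω // u ∈ G.1 ∧ ‖u‖ = 1}, weightForm hK hΩ ρ u.1 u.1 := by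
  have hsphere : ∀ u : XHilbert hK Ω, form K (incl hK hΩ u) (incl hK hΩ u) = 1 ↔ ‖u‖ = 1 :=
    fun u => by rw [← norm_sq_eq_form, pow_eq_one_iff_of_nonneg (norm_nonneg u) two_ne_zero]
  let toSphere (u : {u : XHilbert hK Ω // u ∈ G.1 ∧ ‖u‖ = 1}) : sphere K (mapIncl hK hΩ G).1 :=
    ⟨incl hK hΩ u.1, ⟨u.1, u.2.1, rfl⟩, (hsphere u.1).2 u.2.2⟩
  have hsurj : Function.Surjective toSphere := by
    rintro ⟨_, ⟨u, hu, rfl⟩, hu1⟩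
    exact ⟨⟨u, hu, (hsphere u).1 hu1⟩, rfl⟩
  refine (hsurj.iInf_congr _ fun u => ?_).symm
  simp only [weightForm_apply, sq, toSphere]

theorem eigenvalue_of_pos (ρ : Lp ℝ ∞ (volume.restrict Ω)) {k : ℤ} (hk : 0 < k) :
    eigenvalue K Ω ρ k = (minimaxValue (weightForm hK hΩ ρ) k.natAbs)⁻¹ := by
  rw [eigenvalue, if_pos hk, minimaxValue]
  exact congrArg _ ((mapIncl_surjective hK hΩ _).iSup_congr _ (iInf_sphere_mapIncl hK hΩ ρ)).symm

end MinimaxTransfer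

theorem real_iSup_neg {ι : Sort*} (f : ι → ℝ) : ⨆ i, -f i = -⨅ i, f i :=
  (congrArg sSup Set.neg_range.symm).trans (Real.sSup_neg _)

theorem real_iInf_neg {ι : Sort*} (f : ι → ℝ) : ⨅ i, -f i = -⨆ i, f i :=
  (congrArg sInf Set.neg_range.symm).trans (Real.sInf_neg _)

theorem setIntegral_neg_weight_mul (ρ : Lp ℝ ∞ (volume.restrict Ω)) (f : E N → ℝ) :
    ∫ x in Ω, (-ρ : Lp ℝ ∞ (volume.restrict Ω)) x * f x = -∫ x in Ω, ρ x * f x := by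
  rw [← integral_neg]
  refine integral_congr_ae ?_
  filter_upwards [Lp.coeFn_neg ρ] with x hx
  rw [hx, Pi.neg_apply, neg_mul]

theorem eigenvalue_of_neg (ρ : Lp ℝ ∞ (volume.restrict Ω)) {k : ℤ} (hk : k < 0) :
    eigenvalue K Ω ρ k = -eigenvalue K Ω (-ρ) (-k) := by
  rw [eigenvalue, eigenvalue, if_neg hk.le.not_gt, if_pos (neg_pos.2 hk), Int.natAbs_neg]
  simp only [setIntegral_neg_weight_mul, real_iInf_neg, real_iSup_neg, inv_neg, neg_neg]

theorem UCP.neg {ρ : Lp ℝ ∞ (volume.restrict Ω)} (hρ : UCP K Ω ρ) : UCP K Ω (-ρ) := by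
  rintro lam u ⟨huX, hu0, heq⟩
  refine hρ (-lam) u ⟨huX, hu0, fun v hv => ?_⟩
  rw [heq v hv, setIntegral_neg_weight_mul, neg_mul_comm]

theorem eigenvalue_lt_of_pos (hK : IsCoerciveKernel K) (hΩ_open : IsOpen Ω)
    (hΩ : volume Ω ≠ ∞) {ρ ρ' : Lp ℝ ∞ (volume.restrict Ω)} (hle : ρ ≤ ρ') (hne : ρ ≠ ρ')
    (hucp : UCP K Ω ρ ∨ UCP K Ω ρ') (hρ : ρ⁺ ≠ 0) {k : ℤ} (hk : 0 < k) :
    eigenvalue K Ω ρ' k < eigenvalue K Ω ρ k := by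
  have hj : 0 < k.natAbs := Int.natAbs_pos.2 hk.ne'
  rw [eigenvalue_of_pos hK hΩ ρ hk, eigenvalue_of_pos hK hΩ ρ' hk]
  exact inv_strictAnti₀ (minimaxValue_weightForm_pos hK hΩ_open hΩ hρ hj)
    (minimaxValue_weightForm_lt hK hΩ_open hΩ hle hne hucp hρ hj)

end Eigenvalues

theorem theorem3p2_general (hK : IsCoerciveKernel K) (hΩ_open : IsOpen Ω) (hΩ : volume Ω ≠ ∞)
    {ρ ρ' : Lp ℝ ∞ (volume.restrict Ω)} (hle : ρ ≤ ρ') (hne : ρ ≠ ρ')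
    (hucp : UCP K Ω ρ ∨ UCP K Ω ρ') {k : ℤ} (hk : Admissible ρ k) (hk' : Admissible ρ' k) :
    eigenvalue K Ω ρ' k < eigenvalue K Ω ρ k := by
  rcases hk with ⟨hk, hρ⟩ | ⟨hk, -⟩
  · exact eigenvalue_lt_of_pos hK hΩ_open hΩ hle hne hucp hρ hk
  · have hρ' : (-ρ')⁺ ≠ 0 := by
      rw [posPart_neg]
      exact (hk'.resolve_left fun h => h.1.not_gt hk).2
    rw [eigenvalue_of_neg ρ hk, eigenvalue_of_neg ρ' hk, neg_lt_neg_iff]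
    exact eigenvalue_lt_of_pos hK hΩ_open hΩ (neg_le_neg hle) (neg_injective.ne hne.symm)
      (hucp.symm.imp UCP.neg UCP.neg) hρ' (neg_pos.2 hk)

end NonlocalEigen

theorem theorem3p2 {N : ℕ} (K : NonlocalEigen.E N → ℝ) (hK : NonlocalEigen.IsKernel K)
    (Ω : Set (NonlocalEigen.E N)) (hΩ_open : IsOpen Ω) (hΩ_bdd : Bornology.IsBounded Ω)
    (ρ ρ' : Lp ℝ ∞ (volume.restrict Ω)) (hρ : ρ ≠ 0) (hρ' : ρ' ≠ 0)
    (hle : ρ ≤ ρ') (hne : ρ ≠ ρ')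
    (hucp : NonlocalEigen.UCP K Ω ρ ∨ NonlocalEigen.UCP K Ω ρ')
    (k : ℤ) (hk : NonlocalEigen.Admissible ρ k) (hk' : NonlocalEigen.Admissible ρ' k) :
    NonlocalEigen.eigenvalue K Ω ρ k > NonlocalEigen.eigenvalue K Ω ρ' k :=
  NonlocalEigen.theorem3p2_general hK.isCoerciveKernel hΩ_open hΩ_bdd.measure_lt_top.ne hle hne
    hucp hk hk'
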